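/- **Setting.** A two-player zero-sum Markov game with finite state space $\mathcal S$, finite action spaces $\mathcal A,\mathcal B$ and horizon $H$ is given by transition probabilities $\mathbb P_h(\cdot\mid x,a,b)$ on $\mathcal S$ and mean rewards $r_h(x,a,b)\in[0,1]$, $h\in[H]$. It is *linear* with feature map $\phi:\mathcal S\times\mathcal A\times\mathcal B\to\mathbb R^d$ if $\|\phi\|_2\le 1$ and for every $h$ there are a vector $\mu_h$ of $d$ signed measures on $\mathcal S$ and $\theta_h\in\mathbb R^d$ with $\mathbb P_h(\cdot\mid x,a,b)=\langle\phi(x,a,b),\mu_h(\cdot)\rangle$, $r_h(x,a,b)=\langle\phi(x,a,b),\theta_h\rangle$ and $\max\{\|\mu_h(\mathcal S)\|_2,\|\theta_h\|_2\}\le\sqrt d$. Policies $\pi=\{\pi_h:\mathcal S\to\Delta_{\mathcal A}\}$ and $\nu=\{\nu_h:\mathcal S\to\Delta_{\mathcal B}\}$ have values $V_h^{\pi,\nu}(x)=\mathbb E_{\pi,\nu}[\sum_{t=h}^H r_t(x_t,a_t,b_t)\mid x_h=x]$ (and $V_{H+1}^{\pi,\nu}=0$); $V_1^{*,\nu}=\max_\pi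 V_1^{\pi,\nu}$ and $V_1^{\pi,*}=\min_\nu V_1^{\pi,\nu}$. A pair $(\pi^*,\nu^*)$ is a Nash equilibrium if $\pi^*$ and $\nu^*$ are best responses to each other at all $(x,h)$, and then $V_h^*=V_h^{\pi^*,\nu^*}$. For $V:\mathcal S\to\mathbb R$ put $[\mathbb V_hV](x,a,b)=\max\{1,[\mathbb P_hV^2](x,a,b)-([\mathbb P_hV](x,a,b))^2\}$. Given an initial distribution $\xi$ on $\mathcal S$ and a behavior policy $\beta=\{\beta_h:\mathcal S\to\Delta_{\mathcal A\times\mathcal B}\}$, a dataset $\mathcal D$ of size $K$ collected in the game $M$ consists of $K$ independent trajectories with $x_1^\tau\sim\xi$, $(a_h^\tau,b_h^\tau)\sim\beta_h(\cdot\mid x_h^\tau)$, $x_{h+1}^\tau\sim\mathbb P_h(\cdot\mid x_h^\tau,a_h^\tau,b_h^\tau)$ and independent reward observations $r_h^\tau\sim\mathcal N(r_h(x_h^\tau,a_h^\tau,b_h^\tau),1)$. For a Nash equilibrium $(\pi^*,\nu^*)$ of $M$ and $\lambda>0$ let $$\mathbf Z_h^*=\sum_{\tau=1}^K\frac{\phi(x_h^\tau,a_h^\tau,b_h^\tau)\phi(x_h^\tau,a_h^\tau,b_h^\tau)^\top}{[\mathbb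 V_hV_{h+1}^*](x_h^\tau,a_h^\tau,b_h^\tau)}+\lambda I_d,\qquad \|u\|_{\mathbf Z^{-1}}=\sqrt{u^\top\mathbf Z^{-1}u}.$$ **Theorem (lower bound for Markov games).** There are universal constants $c,C>0$ such that the following holds for every horizon $H\ge1$, dimension $d\ge2$, $\delta\in(0,1)$ and sample size $K\ge C\,d^4\log(2Hd/\delta)$. There exist finite $\mathcal S,\mathcal A,\mathcal B$, a feature map $\phi$ into $\mathbb R^d$, an initial distribution $\xi$, a behavior policy $\beta$ and a nonempty class $\mathcal M$ of Markov games of horizon $H$, all linear with feature map $\phi$, each having a Nash equilibrium and satisfying $\lambda_{\min}(\mathbb E_\beta[\phi(x_h,a_h,b_h)\phi(x_h,a_h,b_h)^\top])>0$ for all $h\in[H]$, such that for every (measurable) map sending a dataset $\mathcal D$ of size $K$ to a policy pair $(\widehat\pi,\widehat\nu)$, every $\lambda>0$, every $M\in\mathcal M$ and every Nash equilibrium $(\pi^*,\nu^*)$ of $M$, with probability at least $1-\delta$ over the dataset $\mathcal D$ collected in $M$, $$\sup_{M'\in\mathcal M}\mathbb E_{M'}\big[V_1^{*,\widehat\nu}(x_1)-V_1^{\widehat\pi,*}(x_1)\big]\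 \ge\ c\sqrt d\,\Big(\max_\nu\sum_{h=1}^H\mathbb E_{\pi^*,\nu}\|\phi(x_h,a_h,b_h)\|_{\mathbf Z_h^{*-1}}+\max_\pi\sum_{h=1}^H\mathbb E_{\pi,\nu^*}\|\phi(x_h,a_h,b_h)\|_{\mathbf Z_h^{*-1}}\Big).$$ Here $\mathbb E_{M'}$ is over a dataset of size $K$ collected in $M'$, from which $(\widehat\pi,\widehat\nu)$ is computed, and an independent $x_1\sim\xi$, with the values taken in $M'$; on the right, $\mathbf Z_h^*$ is computed from $\mathcal D$ and $\mathbb E_{\pi,\nu}$ is over a fresh trajectory of $M$ with $x_1\sim\xi$ and $\mathcal D$ fixed. -/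

import Mathlib

open MeasureTheory ProbabilityTheory
open scoped Matrix

noncomputable section

namespace OfflineMG

/-- A two-player zero-sum Markov game of horizon `H` on finite state and action spaces, with
(mean) rewards in `[0, 1]`. Steps are numbered `0, …, H - 1`. -/
structure MarkovGame (S A B : Type) [Fintype S] (H : ℕ) where
  /-- `P h s a b s'` is the probability of moving to `s'` at step `h`. -/
  P : Fin H → S → A → B → stdSimplex ℝ S
  /-- The mean reward. -/
  r : Fin H → S → A → B → ℝ
  r_mem : ∀ h s a b, r h s a b ∈ Set.Icc (0 : ℝ) 1

/-- A (stochastic, Markov) policy of one player with action space `A`. -/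
abbrev Policy (S A : Type) [Fintype A] (H : ℕ) : Type := Fin H → S → stdSimplex ℝ A

/-- The steps `h, h + 1, …, H - 1`. -/
abbrev Step (H h : ℕ) : Type := {t : Fin H // h ≤ (t : ℕ)}

/-- State-action paths `(x_t, a_t, b_t)` for `t = h, …, H - 1`. -/
def Path (S A B : Type) (H h : ℕ) : Type := Step H h → S × A × B

instance {S A B : Type} [Fintype S] [Fintype A] [Fintype B] {H h : ℕ} :
    Fintype (Path S A B H h) :=
  inferInstanceAs (Fintype (Step H h → S × A × B))

instance {S A B : Type} {H h : ℕ} : MeasurableSpace (Path S A B H h) := ⊤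

/-- The joint action probabilities when the two players act independently. -/
def jointPolicy {S A B : Type} [Fintype A] [Fintype B] {H : ℕ}
    (π : Policy S A H) (ν : Policy S B H) : Fin H → S → A × B → ℝ :=
  fun t s ab => (π t s).1 ab.1 * (ν t s).1 ab.2

/-- A game is linear with feature map `φ`. A vector of `d` signed measures on the finite set `S` is
given by its values `μ s' ∈ ℝ^d` at the points `s'`, and its total mass is `∑ s', μ s'`. -/
def IsLinear {S A B : Type} [Fintype S] {H d : ℕ} (G : MarkovGame S A B H)
    (φ : S → A → B → EuclideanSpace ℝ (Fin d)) : Prop :=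
  (∀ s a b, ‖φ s a b‖ ≤ 1) ∧
  ∀ h, ∃ (μ : S → EuclideanSpace ℝ (Fin d)) (θ : EuclideanSpace ℝ (Fin d)),
    (∀ s a b, (∀ s', (G.P h s a b).1 s' = inner ℝ (φ s a b) (μ s')) ∧
      G.r h s a b = inner ℝ (φ s a b) θ) ∧
    ‖∑ s', μ s'‖ ≤ √(d : ℝ) ∧ ‖θ‖ ≤ √(d : ℝ)

section Game

variable {S A B : Type} [Fintype S] [DecidableEq S] [Fintype A] [Fintype B] {H d : ℕ}

/-- The probability of the path `p` over the steps `h, …, H - 1` when `x_h ∼ ξ`,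
`(a_t, b_t) ∼ σ_t(· | x_t)` and `x_{t+1} ∼ P_t(· | x_t, a_t, b_t)`. -/
def pathProb (G : MarkovGame S A B H) (ξ : S → ℝ) (σ : Fin H → S → A × B → ℝ) (h : ℕ)
    (p : Path S A B H h) : ℝ :=
  (∏ t : Step H h, if (t.1 : ℕ) = h then ξ (p t).1 else 1) *
  (∏ t : Step H h, σ t.1 (p t).1 (p t).2) *
  ∏ t : Step H h, ∏ t' : Step H h,
    if (t'.1 : ℕ) = (t.1 : ℕ) + 1 then (G.P t.1 (p t).1 (p t).2.1 (p t).2.2).1 (p t').1 else 1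

/-- The expectation of `∑_{t ≥ h} f_t(x_t, a_t, b_t)` under the path law above. -/
def expSum (G : MarkovGame S A B H) (ξ : S → ℝ) (σ : Fin H → S → A × B → ℝ) (h : ℕ)
    (f : Fin H → S → A → B → ℝ) : ℝ :=
  ∑ p : Path S A B H h,
    pathProb G ξ σ h p * ∑ t : Step H h, f t.1 (p t).1 (p t).2.1 (p t).2.2

/-- The value function `V_h^{π,ν}(x) = E_{π,ν}[∑_{t ≥ h} r_t | x_h = x]`; it vanishes at `h = H`. -/
def value (G : MarkovGame S A B H) (π : Policy S A H) (ν : Policy S B H) (h : ℕ) (x : S) : ℝ :=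
  expSum G (fun s => if s = x then 1 else 0) (jointPolicy π ν) h G.r

/-- `(π, ν)` is a Nash equilibrium: each is a best response to the other, from every step and
state. -/
def IsNash (G : MarkovGame S A B H) (π : Policy S A H) (ν : Policy S B H) : Prop :=
  (∀ π' : Policy S A H, ∀ (h : Fin H) (x : S), value G π' ν h x ≤ value G π ν h x) ∧
  (∀ ν' : Policy S B H, ∀ (h : Fin H) (x : S), value G π ν h x ≤ value G π ν' h x)

/-- The duality gap `V_1^{*,ν}(x) - V_1^{π,*}(x)` at the initial step. -/
def dualityGap (G : MarkovGame S A B H) (π : Policy S A H) (ν : Policy S B H) (x : S) : ℝ :=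
  (⨆ π' : Policy S A H, value G π' ν 0 x) - ⨅ ν' : Policy S B H, value G π ν' 0 x

/-- The truncated conditional variance `max {1, [P_h V²] - [P_h V]²}`. -/
def truncVar (G : MarkovGame S A B H) (h : Fin H) (V : S → ℝ) (s : S) (a : A) (b : B) : ℝ :=
  max 1 ((∑ s', (G.P h s a b).1 s' * V s' ^ 2) - (∑ s', (G.P h s a b).1 s' * V s') ^ 2)

/-- A trajectory: its states and actions at all steps, and its observed rewards. -/
abbrev Trajectory (S A B : Type) (H : ℕ) : Type := Path S A B H 0 × (Step H 0 → ℝ)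

/-- A dataset of `K` trajectories. -/
abbrev Dataset (S A B : Type) (H K : ℕ) : Type := Fin K → Trajectory S A B H

/-- The law of one trajectory with `x_1 ∼ ξ`, actions from the behavior policy `β`, and, given the
states and actions, independent reward observations `r_h^τ ∼ N(r_h(x_h, a_h, b_h), 1)`. -/
def trajectoryLaw (G : MarkovGame S A B H) (ξ : stdSimplex ℝ S)
    (β : Fin H → S → stdSimplex ℝ (A × B)) : Measure (Trajectory S A B H) :=
  ∑ p : Path S A B H 0,
    ENNReal.ofReal (pathProb G ξ.1 (fun t s => (β t s).1) 0 p) •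
      (Measure.dirac p).prod
        (Measure.pi fun t : Step H 0 => gaussianReal (G.r t.1 (p t).1 (p t).2.1 (p t).2.2) 1)

/-- The law of a dataset of `K` independent trajectories. -/
def datasetLaw (G : MarkovGame S A B H) (ξ : stdSimplex ℝ S)
    (β : Fin H → S → stdSimplex ℝ (A × B)) (K : ℕ) : Measure (Dataset S A B H K) :=
  Measure.pi fun _ : Fin K => trajectoryLaw G ξ β

/-- The covariance matrix `E[φ(x_h, a_h, b_h) φ(x_h, a_h, b_h)ᵀ]` under the behavior policy. -/
def featureCov (G : MarkovGame S A B H) (φ : S → A → B → EuclideanSpace ℝ (Fin d))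
    (ξ : stdSimplex ℝ S) (β : Fin H → S → stdSimplex ℝ (A × B)) (h : Step H 0) :
    Matrix (Fin d) (Fin d) ℝ :=
  ∑ p : Path S A B H 0, pathProb G ξ.1 (fun t s => (β t s).1) 0 p •
    Matrix.vecMulVec (φ (p h).1 (p h).2.1 (p h).2.2).ofLp (φ (p h).1 (p h).2.1 (p h).2.2).ofLp

/-- The expected duality gap `E[V_1^{*,ν̂}(x_1) - V_1^{π̂,*}(x_1)]` of the output of `alg`, over a
dataset collected in `G` and an independent `x_1 ∼ ξ`. -/
def expectedGap (G : MarkovGame S A B H) (ξ : stdSimplex ℝ S)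
    (β : Fin H → S → stdSimplex ℝ (A × B)) {K : ℕ}
    (alg : Dataset S A B H K → Policy S A H × Policy S B H) : ℝ :=
  ∫ D, ∑ x, ξ.1 x * dualityGap G (alg D).1 (alg D).2 x ∂(datasetLaw G ξ β K)

/-- The matrix `Z*_h` of the dataset `D` and the equilibrium `(π, ν)` (so that `V* = V^{π,ν}`). -/
def Zstar (G : MarkovGame S A B H) (φ : S → A → B → EuclideanSpace ℝ (Fin d)) (reg : ℝ)
    (π : Policy S A H) (ν : Policy S B H) {K : ℕ} (D : Dataset S A B H K) (h : Fin H) :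
    Matrix (Fin d) (Fin d) ℝ :=
  (∑ τ : Fin K,
    let z := (D τ).1 ⟨h, Nat.zero_le _⟩
    (truncVar G h (value G π ν (h + 1)) z.1 z.2.1 z.2.2)⁻¹ •
      Matrix.vecMulVec (φ z.1 z.2.1 z.2.2).ofLp (φ z.1 z.2.1 z.2.2).ofLp) +
  reg • (1 : Matrix (Fin d) (Fin d) ℝ)

/-- `‖v‖_{Z⁻¹} = √(vᵀ Z⁻¹ v)`. -/
def invNorm (Z : Matrix (Fin d) (Fin d) ℝ) (v : EuclideanSpace ℝ (Fin d)) : ℝ :=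
  √(v.ofLp ⬝ᵥ (Z⁻¹ *ᵥ v.ofLp))

/-- `max_ν' ∑_h E_{π,ν'} ‖φ‖_{Z*_h⁻¹} + max_π' ∑_h E_{π',ν} ‖φ‖_{Z*_h⁻¹}` for the
equilibrium `(π, ν)`; the expectations are over a fresh path with `x_1 ∼ ξ`, for a fixed `D`. -/
def complexity (G : MarkovGame S A B H) (φ : S → A → B → EuclideanSpace ℝ (Fin d)) (reg : ℝ)
    (ξ : stdSimplex ℝ S) (π : Policy S A H) (ν : Policy S B H) {K : ℕ}
    (D : Dataset S A B H K) : ℝ :=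
  (⨆ ν' : Policy S B H, expSum G ξ.1 (jointPolicy π ν') 0
      fun h s a b => invNorm (Zstar G φ reg π ν D h) (φ s a b)) +
  ⨆ π' : Policy S A H, expSum G ξ.1 (jointPolicy π' ν) 0
      fun h s a b => invNorm (Zstar G φ reg π ν D h) (φ s a b)

end Game

end OfflineMG

end

/-! The hard instance has a single state and is an Assouad hypercube. With `k = d - 1`, both players
choose sign vectors in `{±1}^k`, and the mean reward at step `h` is `1/2 + Δ⟨θ_h, (a - b)/2⟩` for
hidden signs `θ_h`. The reward splits into a function of `a` and a function of `b`, so playing `θ`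
is dominant for both players, and the duality gap is a sum over steps and coordinates of the
disagreement with the hidden sign (`dualityGap_signGame`).

The behavior policy is uniform on the `2k` pairs with `(a - b)/2 = ±e_i`. Flipping one hidden sign
changes the rewards of only two of these pairs, which are played with probability `1/k`, so the
second moment of the likelihood ratio of one trajectory is `1 + (exp(4Δ²) - 1)/k`
(`integral_likelihoodRatio_flipSign_sq`). With `Δ = √k / (8√K)` its `K`-th power stays below `5/4`:
no algorithm can tell neighbouring games apart, each coordinate costs a constant multiple of `Δ` on
average over `θ`, and some game in the class has expected gap at least `(3/4) Δ H k`, of order `H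
k^{3/2}/√K` (`le_sum_expectedGap_signGame`).

For the right-hand side, the values have zero conditional variance, so `Z*` is the plain regularised
Gram matrix. With probability `1 - δ` each of the `2k` pairs is seen at least `K/(4k)` times at
every step. Every feature is a combination of the probed features with squared coefficients summing
to at most `k`, so its elliptical norm is at most `√(k / (K/(4k))) = 2k/√K` (`invNorm_Zstar_le`).
The complexity is then at most `4Hk/√K`, and multiplying by `√d` gives the order of the gap. -/

/-! ### Product densities, Gaussian likelihood ratios and a Chernoff bound. -/

/-- The product of measures with densities has the product density. -/
theorem pi_withDensity_ofReal {ι X : Type*} [Fintype ι] [MeasurableSpace X]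
    (P Q : ι → Measure X) [∀ i, IsProbabilityMeasure (P i)] [∀ i, IsProbabilityMeasure (Q i)]
    (f : ι → X → ℝ) (hf0 : ∀ i x, 0 ≤ f i x)
    (hfi : ∀ i, Integrable (f i) (P i))
    (hQ : ∀ i, Q i = (P i).withDensity fun x => ENNReal.ofReal (f i x)) :
    Measure.pi Q = (Measure.pi P).withDensity fun x => ENNReal.ofReal (∏ i, f i (x i)) := by
  refine Measure.pi_eq (μ := Q) fun s hs => ?_
  -- On a box, the indicator times the product density is a product of one-coordinate functions, so
  -- the integral factors.
  rw [withDensity_apply _ (MeasurableSet.univ_pi hs),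
    ← lintegral_indicator (MeasurableSet.univ_pi hs)]
  have hind : ∀ x : ι → X, (Set.univ.pi s).indicator
      (fun x => ENNReal.ofReal (∏ i, f i (x i))) x
        = ENNReal.ofReal (∏ i, (s i).indicator (f i) (x i)) := by
    intro x
    by_cases hx : x ∈ Set.univ.pi s
    · rw [Set.indicator_of_mem hx]
      congr 1
      exact Finset.prod_congr rfl fun i _ =>
        (Set.indicator_of_mem (hx i (Set.mem_univ i)) _).symm
    · rw [Set.indicator_of_notMem hx]
      simp only [Set.mem_pi, Set.mem_univ, true_implies, not_forall] at hx
      obtain ⟨i, hi⟩ := hx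
      rw [Finset.prod_eq_zero (Finset.mem_univ i) (Set.indicator_of_notMem hi _),
        ENNReal.ofReal_zero]
  have hint : ∀ i, Integrable ((s i).indicator (f i)) (P i) :=
    fun i => (hfi i).indicator (hs i)
  have hnn : ∀ i x, 0 ≤ (s i).indicator (f i) x :=
    fun i x => Set.indicator_nonneg (fun y _ => hf0 i y) x
  simp_rw [hind]
  rw [← ofReal_integral_eq_lintegral_ofReal (Integrable.fintype_prod_dep hint)
    (ae_of_all _ fun x => Finset.prod_nonneg fun i _ => hnn i _),
    integral_fintype_prod_eq_prod (𝕜 := ℝ),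
    ENNReal.ofReal_prod_of_nonneg fun i _ => integral_nonneg (hnn i)]
  refine Finset.prod_congr rfl fun i _ => ?_
  rw [hQ i, withDensity_apply _ (hs i), ← lintegral_indicator (hs i),
    ofReal_integral_eq_lintegral_ofReal (hint i) (ae_of_all _ (hnn i))]
  refine lintegral_congr fun x => ?_
  by_cases hx : x ∈ s i <;> simp [hx]

/-- If `Q` has density `f` with respect to `P`, the difference of the expectations of a bounded
function is controlled by the `χ²`-divergence. -/
theorem abs_integral_sub_integral_le_of_sq_density {X : Type*} [MeasurableSpace X]
    {P Q : Measure X} [IsProbabilityMeasure P] [IsProbabilityMeasure Q] {f : X → ℝ}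
    (hf : Measurable f) (hf0 : ∀ x, 0 ≤ f x)
    (hfi : Integrable f P) (hf2 : Integrable (fun x => f x ^ 2) P)
    (hQ : Q = P.withDensity fun x => ENNReal.ofReal (f x))
    {ε : ℝ} (hε : 0 < ε) (hχ : ∫ x, f x ^ 2 ∂P ≤ 1 + ε ^ 2)
    {g : X → ℝ} (hg : Measurable g) {M : ℝ} (hM : ∀ x, |g x| ≤ M) :
    |∫ x, g x ∂Q - ∫ x, g x ∂P| ≤ M * ε := by
  have h1 : ∫ x, f x ∂P = 1 := by
    have h : (Q Set.univ).toReal = 1 := by simp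
    rw [hQ, withDensity_apply _ MeasurableSet.univ, Measure.restrict_univ,
      ← ofReal_integral_eq_lintegral_ofReal hfi (ae_of_all _ hf0),
      ENNReal.toReal_ofReal (integral_nonneg hf0)] at h
    exact h
  have hgQ : ∫ x, g x ∂Q = ∫ x, f x * g x ∂P := by
    rw [hQ, integral_withDensity_eq_integral_toReal_smul hf.ennreal_ofReal
      (ae_of_all _ fun x => ENNReal.ofReal_lt_top)]
    simp [ENNReal.toReal_ofReal (hf0 _)]
  have hgP : Integrable g P := Integrable.of_bound hg.aestronglyMeasurable M (ae_of_all _ hM)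
  have hfg : Integrable (fun x => f x * g x) P :=
    hfi.mul_bdd (c := M) hg.aestronglyMeasurable (ae_of_all _ hM)
  have hsqi : Integrable (fun x => (f x - 1) ^ 2) P := by
    have : (fun x => (f x - 1) ^ 2) = fun x => f x ^ 2 - 2 * f x + 1 := by
      funext x; ring
    rw [this]
    exact (hf2.sub (hfi.const_mul 2)).add (integrable_const 1)
  have hsq : ∫ x, (f x - 1) ^ 2 ∂P ≤ ε ^ 2 := by
    have : (fun x => (f x - 1) ^ 2) = fun x => (f x ^ 2 - 2 * f x) + 1 := by
      funext x; ring
    have hi : Integrable (fun x => f x ^ 2 - 2 * f x) P := hf2.sub (hfi.const_mul 2)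
    rw [this, integral_add hi (integrable_const 1),
      integral_sub hf2 (hfi.const_mul 2), integral_const_mul, h1]
    simp
    linarith
  have hM0 : 0 ≤ M := by
    by_contra h
    have : ∀ x : X, False := fun x => absurd ((abs_nonneg _).trans (hM x)) h
    have hP : P Set.univ = 0 := by
      rw [Set.eq_empty_of_forall_notMem (s := Set.univ) fun x _ => this x]; simp
    simp at hP
  rw [hgQ, ← integral_sub hfg hgP]
  calc |∫ x, (f x * g x - g x) ∂P| ≤ ∫ x, |f x * g x - g x| ∂P := abs_integral_le_integral_abs
    _ ≤ ∫ x, M / (2 * ε) * ((f x - 1) ^ 2 + ε ^ 2) ∂P := by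
      refine integral_mono (hfg.sub hgP).abs
        ((hsqi.add (integrable_const _)).const_mul _) fun x => ?_
      -- Pointwise AM-GM with weight `ε` replaces Cauchy–Schwarz; it loses nothing when the
      -- `χ²`-divergence equals `ε²`.
      have h2 : |f x - 1| ≤ ((f x - 1) ^ 2 + ε ^ 2) / (2 * ε) := by
        rw [le_div_iff₀ (by positivity), ← sq_abs (f x - 1)]
        nlinarith [sq_nonneg (|f x - 1| - ε)]
      calc |f x * g x - g x| = |f x - 1| * |g x| := by rw [← abs_mul]; ring_nf
        _ ≤ ((f x - 1) ^ 2 + ε ^ 2) / (2 * ε) * M := by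
          gcongr; exact hM x
        _ = _ := by ring
    _ = M / (2 * ε) * (∫ x, (f x - 1) ^ 2 ∂P + ε ^ 2) := by
      rw [integral_const_mul, integral_add hsqi (integrable_const _)]
      simp
    _ ≤ M / (2 * ε) * (ε ^ 2 + ε ^ 2) := by gcongr
    _ = M * ε := by field_simp; ring

/-- The likelihood ratio of `N(m', 1)` with respect to `N(m, 1)`. -/
noncomputable def gaussianRatio (m m' x : ℝ) : ℝ :=
  Real.exp ((m' - m) * (x - m) - (m' - m) ^ 2 / 2)

@[fun_prop]
theorem measurable_gaussianRatio (m m' : ℝ) : Measurable (gaussianRatio m m') := by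
  unfold gaussianRatio; fun_prop

theorem gaussianReal_eq_withDensity_gaussianRatio (m m' : ℝ) :
    gaussianReal m' 1 =
      (gaussianReal m 1).withDensity fun x => ENNReal.ofReal (gaussianRatio m m' x) := by
  rw [gaussianReal_of_var_ne_zero _ one_ne_zero, gaussianReal_of_var_ne_zero _ one_ne_zero,
    ← withDensity_mul _ (measurable_gaussianPDF m 1) (by fun_prop)]
  congr 1
  funext x
  simp only [Pi.mul_apply, gaussianPDF, gaussianPDFReal, gaussianRatio]
  rw [← ENNReal.ofReal_mul (by positivity), mul_assoc _ (Real.exp _), ← Real.exp_add]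
  congr 3
  push_cast
  ring

theorem integrable_gaussianRatio (m m' : ℝ) :
    Integrable (gaussianRatio m m') (gaussianReal m 1) := by
  have : gaussianRatio m m' = fun x =>
      Real.exp (-(m' - m) * m - (m' - m) ^ 2 / 2) * Real.exp ((m' - m) * x) := by
    funext x; rw [gaussianRatio, ← Real.exp_add]; ring_nf
  rw [this]
  exact (integrable_exp_mul_gaussianReal _).const_mul _

/-- In this form integrals of the squared ratio are values of the Gaussian moment generating
function. -/
theorem gaussianRatio_sq (m m' x : ℝ) : gaussianRatio m m' x ^ 2 =
    Real.exp (-2 * (m' - m) * m - (m' - m) ^ 2) * Real.exp ((2 * (m' - m)) * x) := by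
  rw [gaussianRatio, ← Real.exp_add, ← Real.exp_nat_mul]
  congr 1
  push_cast
  ring

theorem integrable_gaussianRatio_sq (m m' : ℝ) :
    Integrable (fun x => gaussianRatio m m' x ^ 2) (gaussianReal m 1) := by
  simp_rw [gaussianRatio_sq]
  exact (integrable_exp_mul_gaussianReal _).const_mul _

theorem integral_gaussianRatio_sq (m m' : ℝ) :
    ∫ x, gaussianRatio m m' x ^ 2 ∂(gaussianReal m 1) = Real.exp ((m' - m) ^ 2) := by
  simp_rw [gaussianRatio_sq]
  have h := congrFun (mgf_id_gaussianReal (μ := m) (v := 1)) (2 * (m' - m))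
  simp only [mgf, id] at h
  rw [integral_const_mul, h, ← Real.exp_add]
  congr 1
  push_cast
  ring

theorem withDensity_map {X Y : Type*} [MeasurableSpace X] [MeasurableSpace Y]
    (μ : Measure X) {g : X → Y} (hg : Measurable g) {f : Y → ENNReal} (hf : Measurable f) :
    (μ.map g).withDensity f = (μ.withDensity (f ∘ g)).map g := by
  ext s hs
  rw [withDensity_apply _ hs, Measure.map_apply hg hs, withDensity_apply _ (hg hs),
    Measure.restrict_map hg hs, lintegral_map hf hg]
  rfl

/-- Chernoff bound: an event of probability at least `p` occurs at most `n p / 2` times in `n`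
independent trials with probability at most `exp (-n p / 10)`. -/
theorem measureReal_pi_count_le {X : Type*} [MeasurableSpace X] (P : Measure X)
    [IsProbabilityMeasure P] (n : ℕ) {E : Set X} [DecidablePred (· ∈ E)] (hE : MeasurableSet E)
    {p : ℝ} (hp : p ≤ P.real E) :
    (Measure.pi fun _ : Fin n => P).real
      {D | ((Finset.univ.filter fun τ => D τ ∈ E).card : ℝ) ≤ n * p / 2} ≤
        Real.exp (-(n * p / 10)) := by
  classical
  -- Exponential Markov inequality with parameter `1`: the mean of `w` is `1 - (1 - e⁻¹) P(E) ≤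
  -- exp(-3p/5)`, and `3/5 - 1/2 = 1/10` is the final rate.
  set w : X → ℝ := fun x => Real.exp (-(E.indicator (fun _ => (1 : ℝ)) x)) with hw
  have hwm : Measurable w := (Measurable.indicator measurable_const hE).neg.exp
  have hwb : ∀ x, |w x| ≤ 1 := by
    intro x
    rw [hw, abs_of_pos (Real.exp_pos _), Real.exp_le_one_iff, neg_nonpos]
    exact Set.indicator_nonneg (fun _ _ => zero_le_one) x
  have hwi : Integrable w P :=
    Integrable.of_bound hwm.aestronglyMeasurable 1 (ae_of_all _ hwb)
  have hw1 : ∀ x, w x = 1 - (1 - Real.exp (-1)) * E.indicator (fun _ => (1 : ℝ)) x := by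
    intro x
    by_cases hx : x ∈ E <;> simp [hw, hx]
  have he : Real.exp (-1) ≤ 2 / 5 := by
    rw [Real.exp_neg]
    have := Real.exp_one_gt_d9
    rw [inv_le_comm₀ (by positivity) (by positivity)]
    linarith
  have hind : Integrable (E.indicator (fun _ => (1 : ℝ))) P :=
    (integrable_const 1).indicator hE
  have hwP : ∫ x, w x ∂P ≤ Real.exp (-(3 / 5 * p)) := by
    have h0 := Real.add_one_le_exp (-(3 / 5 * P.real E))
    have h2 : Real.exp (-(3 / 5 * P.real E)) ≤ Real.exp (-(3 / 5 * p)) := by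
      apply Real.exp_le_exp.2; linarith
    have h3 : ∫ x, w x ∂P = 1 - (1 - Real.exp (-1)) * P.real E := by
      simp_rw [hw1]
      rw [integral_sub (integrable_const _) (hind.const_mul _), integral_const_mul,
        integral_indicator_const _ hE]
      simp
    have h4 : 0 ≤ P.real E := measureReal_nonneg
    nlinarith
  have hw0 : 0 ≤ ∫ x, w x ∂P := integral_nonneg fun x => (Real.exp_pos _).le
  have hF : ∫ D, ∏ τ, w (D τ) ∂(Measure.pi fun _ : Fin n => P) ≤
      Real.exp (-(3 / 5 * p)) ^ n := by
    rw [integral_fintype_prod_eq_pow (𝕜 := ℝ), Fintype.card_fin]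
    exact pow_le_pow_left₀ hw0 hwP n
  have hFi : Integrable (fun D : Fin n → X => ∏ τ, w (D τ)) (Measure.pi fun _ : Fin n => P) :=
    Integrable.fintype_prod_dep fun _ => hwi
  have hmark := mul_meas_ge_le_integral_of_nonneg
    (ae_of_all _ fun D : Fin n → X => Finset.prod_nonneg fun τ _ => (Real.exp_pos _).le) hFi
    (Real.exp (-(n * p / 2)))
  have hsub : {D : Fin n → X |
      ((Finset.univ.filter fun τ => D τ ∈ E).card : ℝ) ≤ n * p / 2} ⊆
      {D | Real.exp (-(n * p / 2)) ≤ ∏ τ, w (D τ)} := by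
    intro D hD
    simp only [Set.mem_ofPred_eq] at hD ⊢
    rw [hw, ← Real.exp_sum, Real.exp_le_exp, Finset.sum_neg_distrib, neg_le_neg_iff]
    refine le_trans (le_of_eq ?_) hD
    simp only [Set.indicator_apply]
    rw [Finset.sum_boole]
  have hle := measureReal_mono (μ := Measure.pi fun _ : Fin n => P) hsub
  have hpos := Real.exp_pos (-(n * p / 2))
  have hfin : (Measure.pi fun _ : Fin n => P).real
      {D | Real.exp (-(n * p / 2)) ≤ ∏ τ, w (D τ)} ≤
      Real.exp (-(3 / 5 * p)) ^ n / Real.exp (-(n * p / 2)) := by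
    rw [le_div_iff₀ hpos, mul_comm]
    exact hmark.trans hF
  refine hle.trans (hfin.trans (le_of_eq ?_))
  rw [← Real.exp_nat_mul, ← Real.exp_sub]
  congr 1
  ring

/-! ### Marginals of finite product distributions. -/

namespace OfflineMG

theorem sum_pi_prod_eq_one {ι X : Type*} [Fintype ι] [DecidableEq ι] [Fintype X]
    (q : ι → X → ℝ) (hq : ∀ t, ∑ x, q t x = 1) : ∑ p : ι → X, ∏ t, q t (p t) = 1 := by
  rw [← Fintype.prod_sum]
  simp [hq]

/-- The one-coordinate marginals of a finite product distribution. -/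
theorem sum_pi_prod_smul {ι X E : Type*} [Fintype ι] [DecidableEq ι] [Fintype X]
    [AddCommGroup E] [Module ℝ E]
    (q : ι → X → ℝ) (hq : ∀ t, ∑ x, q t x = 1) (t₀ : ι) (f : X → E) :
    ∑ p : ι → X, (∏ t, q t (p t)) • f (p t₀) = ∑ x, q t₀ x • f x := by
  classical
  have hmarg : ∀ x, ∑ p : ι → X, (if p t₀ = x then ∏ t, q t (p t) else 0) = q t₀ x := by
    intro x
    -- Absorbing the constraint into the factor at `t₀` makes the sum over `p` a product of sums,
    -- all equal to `1` except that one.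
    have h : ∀ p : ι → X, (if p t₀ = x then ∏ t, q t (p t) else 0) =
        ∏ t, if t = t₀ then (if p t = x then q t (p t) else 0) else q t (p t) := by
      intro p
      by_cases hp : p t₀ = x
      · rw [if_pos hp]
        refine Finset.prod_congr rfl fun t _ => ?_
        split_ifs with h1 h2
        · rfl
        · exact absurd (h1 ▸ hp) h2
        · rfl
      · rw [if_neg hp, Finset.prod_eq_zero (Finset.mem_univ t₀)]
        simp [hp]
    simp_rw [h]
    rw [← Fintype.prod_sum (f := fun t y =>
      if t = t₀ then (if y = x then q t y else 0) else q t y)]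
    rw [Finset.prod_eq_single t₀]
    · simp
    · intro t _ ht
      simp [ht, hq]
    · simp
  calc ∑ p : ι → X, (∏ t, q t (p t)) • f (p t₀)
      = ∑ p : ι → X, ∑ x, (if p t₀ = x then ∏ t, q t (p t) else 0) • f x := by
        refine Finset.sum_congr rfl fun p _ => ?_
        simp [ite_smul]
    _ = _ := by
        rw [Finset.sum_comm]
        refine Finset.sum_congr rfl fun x _ => ?_
        rw [← Finset.sum_smul, hmarg]

/-! ### Change of measure between games with the same transitions. -/

section Trajectories

variable {S A B : Type} [Fintype S] {H : ℕ}

theorem pathProb_congr {G G' : MarkovGame S A B H} (hP : G.P = G'.P) (ξ : S → ℝ)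
    (σ : Fin H → S → A × B → ℝ) (h : ℕ) (p : Path S A B H h) :
    pathProb G ξ σ h p = pathProb G' ξ σ h p := by
  simp only [pathProb, hP]

theorem pathProb_nonneg (G : MarkovGame S A B H) {ξ : S → ℝ} (hξ : ∀ s, 0 ≤ ξ s)
    {σ : Fin H → S → A × B → ℝ} (hσ : ∀ t s ab, 0 ≤ σ t s ab) (h : ℕ) (p : Path S A B H h) :
    0 ≤ pathProb G ξ σ h p := by
  unfold pathProb
  refine mul_nonneg (mul_nonneg ?_ ?_) ?_
  · exact Finset.prod_nonneg fun t _ => by split_ifs <;> simp [hξ]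
  · exact Finset.prod_nonneg fun t _ => hσ _ _ _
  · exact Finset.prod_nonneg fun t _ => Finset.prod_nonneg fun t' _ => by
      split_ifs
      · exact (G.P _ _ _ _).2.1 _
      · exact zero_le_one

/-- The likelihood ratio of a trajectory between two games with the same transitions. -/
noncomputable def likelihoodRatio (G G' : MarkovGame S A B H) (z : Trajectory S A B H) : ℝ :=
  ∏ t : Step H 0, gaussianRatio (G.r t.1 (z.1 t).1 (z.1 t).2.1 (z.1 t).2.2)
    (G'.r t.1 (z.1 t).1 (z.1 t).2.1 (z.1 t).2.2) (z.2 t)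

theorem likelihoodRatio_nonneg (G G' : MarkovGame S A B H) (z : Trajectory S A B H) :
    0 ≤ likelihoodRatio G G' z :=
  Finset.prod_nonneg fun _ _ => (Real.exp_pos _).le

theorem integrable_pi_likelihoodRatio (G G' : MarkovGame S A B H) (p : Path S A B H 0) :
    Integrable (fun r => likelihoodRatio G G' (p, r)) (Measure.pi fun t : Step H 0 =>
      gaussianReal (G.r t.1 (p t).1 (p t).2.1 (p t).2.2) 1) := by
  simp only [likelihoodRatio]
  exact Integrable.fintype_prod_dep
    (μ := fun t : Step H 0 => gaussianReal (G.r t.1 (p t).1 (p t).2.1 (p t).2.2) 1)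
    fun _ => integrable_gaussianRatio _ _

theorem integrable_pi_likelihoodRatio_sq (G G' : MarkovGame S A B H) (p : Path S A B H 0) :
    Integrable (fun r => likelihoodRatio G G' (p, r) ^ 2) (Measure.pi fun t : Step H 0 =>
      gaussianReal (G.r t.1 (p t).1 (p t).2.1 (p t).2.2) 1) := by
  simp only [likelihoodRatio, ← Finset.prod_pow]
  exact Integrable.fintype_prod_dep
    (μ := fun t : Step H 0 => gaussianReal (G.r t.1 (p t).1 (p t).2.1 (p t).2.2) 1)
    fun _ => integrable_gaussianRatio_sq _ _

variable [Fintype A] [Fintype B]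

theorem measurable_likelihoodRatio (G G' : MarkovGame S A B H) :
    Measurable (likelihoodRatio G G') := by
  refine measurable_from_prod_countable_right fun p => ?_
  simp only [likelihoodRatio]
  fun_prop

/-- Equal transitions give each path the same weight in both games, so only the Gaussian reward
factors contribute to the density. -/
theorem trajectoryLaw_eq_withDensity {G G' : MarkovGame S A B H} (hP : G.P = G'.P)
    (ξ : stdSimplex ℝ S) (β : Fin H → S → stdSimplex ℝ (A × B)) :
    trajectoryLaw G' ξ β = (trajectoryLaw G ξ β).withDensity
      fun z => ENNReal.ofReal (likelihoodRatio G G' z) := by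
  have hm : Measurable fun z => ENNReal.ofReal (likelihoodRatio G G' z) :=
    (measurable_likelihoodRatio G G').ennreal_ofReal
  unfold trajectoryLaw
  rw [← Measure.sum_fintype, ← Measure.sum_fintype, withDensity_sum]
  congr 1
  funext p
  rw [withDensity_smul_measure, pathProb_congr hP, Measure.dirac_prod, Measure.dirac_prod,
    withDensity_map _ measurable_prodMk_left hm]
  congr 2
  exact pi_withDensity_ofReal
    (fun t : Step H 0 => gaussianReal (G.r t.1 (p t).1 (p t).2.1 (p t).2.2) 1)
    (fun t : Step H 0 => gaussianReal (G'.r t.1 (p t).1 (p t).2.1 (p t).2.2) 1)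
    (fun t => gaussianRatio (G.r t.1 (p t).1 (p t).2.1 (p t).2.2)
      (G'.r t.1 (p t).1 (p t).2.1 (p t).2.2)) (fun _ _ => (Real.exp_pos _).le)
    (fun t => integrable_gaussianRatio _ _)
    (fun t => gaussianReal_eq_withDensity_gaussianRatio _ _)

theorem integrable_trajectoryLaw (G : MarkovGame S A B H) (ξ : stdSimplex ℝ S)
    (β : Fin H → S → stdSimplex ℝ (A × B)) {F : Trajectory S A B H → ℝ} (hF : Measurable F)
    (hFi : ∀ p, Integrable (fun r => F (p, r)) (Measure.pi fun t : Step H 0 =>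
      gaussianReal (G.r t.1 (p t).1 (p t).2.1 (p t).2.2) 1)) :
    Integrable F (trajectoryLaw G ξ β) := by
  unfold trajectoryLaw
  refine integrable_finsetSum_measure.2 fun p _ => ?_
  refine Integrable.smul_measure ?_ ENNReal.ofReal_ne_top
  rw [Measure.dirac_prod, integrable_map_measure hF.aestronglyMeasurable
    measurable_prodMk_left.aemeasurable]
  exact hFi p

theorem integral_trajectoryLaw (G : MarkovGame S A B H) (ξ : stdSimplex ℝ S)
    (β : Fin H → S → stdSimplex ℝ (A × B)) {F : Trajectory S A B H → ℝ} (hF : Measurable F)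
    (hFi : ∀ p, Integrable (fun r => F (p, r)) (Measure.pi fun t : Step H 0 =>
      gaussianReal (G.r t.1 (p t).1 (p t).2.1 (p t).2.2) 1)) :
    ∫ z, F z ∂(trajectoryLaw G ξ β) = ∑ p : Path S A B H 0,
      pathProb G ξ.1 (fun t s => (β t s).1) 0 p * ∫ r, F (p, r) ∂(Measure.pi fun t : Step H 0 =>
        gaussianReal (G.r t.1 (p t).1 (p t).2.1 (p t).2.2) 1) := by
  unfold trajectoryLaw
  rw [integral_finsetSum_measure]
  · refine Finset.sum_congr rfl fun p _ => ?_
    rw [integral_smul_measure, Measure.dirac_prod,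
      integral_map measurable_prodMk_left.aemeasurable hF.aestronglyMeasurable,
      ENNReal.toReal_ofReal, smul_eq_mul]
    exact pathProb_nonneg G ξ.2.1 (fun t s ab => (β t s).2.1 ab) 0 p
  · intro p _
    refine Integrable.smul_measure ?_ ENNReal.ofReal_ne_top
    rw [Measure.dirac_prod, integrable_map_measure hF.aestronglyMeasurable
      measurable_prodMk_left.aemeasurable]
    exact hFi p

theorem integral_likelihoodRatio_sq (G G' : MarkovGame S A B H) (ξ : stdSimplex ℝ S)
    (β : Fin H → S → stdSimplex ℝ (A × B)) :
    ∫ z, likelihoodRatio G G' z ^ 2 ∂(trajectoryLaw G ξ β) = ∑ p : Path S A B H 0,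
      pathProb G ξ.1 (fun t s => (β t s).1) 0 p *
        ∏ t : Step H 0, Real.exp ((G'.r t.1 (p t).1 (p t).2.1 (p t).2.2 -
          G.r t.1 (p t).1 (p t).2.1 (p t).2.2) ^ 2) := by
  rw [integral_trajectoryLaw G ξ β ((measurable_likelihoodRatio G G').pow_const 2)
    (integrable_pi_likelihoodRatio_sq G G')]
  refine Finset.sum_congr rfl fun p _ => ?_
  congr 1
  simp only [likelihoodRatio, ← Finset.prod_pow]
  rw [integral_fintype_prod_eq_prod (𝕜 := ℝ)
    (μ := fun t : Step H 0 => gaussianReal (G.r t.1 (p t).1 (p t).2.1 (p t).2.2) 1)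
    (f := fun t x => gaussianRatio (G.r t.1 (p t).1 (p t).2.1 (p t).2.2)
      (G'.r t.1 (p t).1 (p t).2.1 (p t).2.2) x ^ 2)]
  exact Finset.prod_congr rfl fun t _ => integral_gaussianRatio_sq _ _

/-- Datasets from two games with the same transitions are statistically close if the likelihood
ratio of one trajectory has a second moment close to `1`. -/
theorem abs_integral_datasetLaw_sub_le {G G' : MarkovGame S A B H} (hP : G.P = G'.P)
    (ξ : stdSimplex ℝ S) (β : Fin H → S → stdSimplex ℝ (A × B))
    [IsProbabilityMeasure (trajectoryLaw G ξ β)] [IsProbabilityMeasure (trajectoryLaw G' ξ β)]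
    {K : ℕ} {ε : ℝ} (hε : 0 < ε)
    (hχ : (∫ z, likelihoodRatio G G' z ^ 2 ∂(trajectoryLaw G ξ β)) ^ K ≤ 1 + ε ^ 2)
    {g : Dataset S A B H K → ℝ} (hg : Measurable g) {M : ℝ} (hM : ∀ D, |g D| ≤ M) :
    |∫ D, g D ∂(datasetLaw G' ξ β K) - ∫ D, g D ∂(datasetLaw G ξ β K)| ≤ M * ε := by
  have hL := measurable_likelihoodRatio G G'
  have hLi : Integrable (likelihoodRatio G G') (trajectoryLaw G ξ β) :=
    integrable_trajectoryLaw G ξ β hL (integrable_pi_likelihoodRatio G G')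
  have hLi2 : Integrable (fun z => likelihoodRatio G G' z ^ 2) (trajectoryLaw G ξ β) :=
    integrable_trajectoryLaw G ξ β (hL.pow_const 2) (integrable_pi_likelihoodRatio_sq G G')
  unfold datasetLaw
  refine abs_integral_sub_integral_le_of_sq_density
    (f := fun D : Dataset S A B H K => ∏ τ, likelihoodRatio G G' (D τ))
    (Finset.measurable_prod _ fun τ _ => hL.comp (measurable_pi_apply τ))
    (fun D => Finset.prod_nonneg fun τ _ => likelihoodRatio_nonneg G G' _)
    (Integrable.fintype_prod_dep fun _ => hLi) ?_ ?_ hε ?_ hg hM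
  · simp only [← Finset.prod_pow]
    exact Integrable.fintype_prod_dep (μ := fun _ : Fin K => trajectoryLaw G ξ β) fun _ => hLi2
  · exact pi_withDensity_ofReal _ _ _ (fun _ => likelihoodRatio_nonneg G G') (fun _ => hLi)
      fun _ => trajectoryLaw_eq_withDensity hP ξ β
  · simp only [← Finset.prod_pow]
    rw [integral_fintype_prod_eq_pow (𝕜 := ℝ) (f := fun z => likelihoodRatio G G' z ^ 2),
      Fintype.card_fin]
    exact hχ

theorem trajectoryLaw_apply (G : MarkovGame S A B H) (ξ : stdSimplex ℝ S)
    (β : Fin H → S → stdSimplex ℝ (A × B)) (E : Set (Path S A B H 0)) [DecidablePred (· ∈ E)] :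
    (trajectoryLaw G ξ β) (Prod.fst ⁻¹' E) = ENNReal.ofReal (∑ p : Path S A B H 0,
      pathProb G ξ.1 (fun t s => (β t s).1) 0 p * if p ∈ E then 1 else 0) := by
  have hE : MeasurableSet (Prod.fst ⁻¹' E : Set (Trajectory S A B H)) :=
    measurable_fst MeasurableSpace.measurableSet_top
  have hnn : ∀ p, 0 ≤ pathProb G ξ.1 (fun t s => (β t s).1) 0 p :=
    pathProb_nonneg G ξ.2.1 (fun t s ab => (β t s).2.1 ab) 0
  unfold trajectoryLaw
  rw [Measure.finsetSum_apply, ENNReal.ofReal_sum_of_nonneg]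
  · refine Finset.sum_congr rfl fun p _ => ?_
    rw [Measure.smul_apply, Measure.dirac_prod, Measure.map_apply measurable_prodMk_left hE,
      smul_eq_mul, ENNReal.ofReal_mul (hnn p)]
    congr 1
    by_cases hp : p ∈ E
    · have : (Prod.mk p ⁻¹' (Prod.fst ⁻¹' E) : Set (Step H 0 → ℝ)) = Set.univ := by
        ext; simp [hp]
      rw [this]; simp [hp]
    · have : (Prod.mk p ⁻¹' (Prod.fst ⁻¹' E) : Set (Step H 0 → ℝ)) = ∅ := by
        ext; simp [hp]
      rw [this]; simp [hp]
  · exact fun p _ => mul_nonneg (hnn p) (by split_ifs <;> simp)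

end Trajectories

/-! ### Games with one state: the steps are independent. -/

section OneState

variable {A B : Type} {H d : ℕ}

theorem transition_unit (G : MarkovGame Unit A B H) (h : Fin H) (s : Unit) (a : A) (b : B)
    (s' : Unit) : (G.P h s a b).1 s' = 1 := by
  simpa using (G.P h s a b).2.2

theorem pathProb_unit (G : MarkovGame Unit A B H) {ξ : Unit → ℝ} (hξ : ξ () = 1)
    (σ : Fin H → Unit → A × B → ℝ) (h : ℕ) (p : Path Unit A B H h) :
    pathProb G ξ σ h p = ∏ t : Step H h, σ t.1 () (p t).2 := by
  simp [pathProb, transition_unit, hξ]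

/-- The next state is deterministic, so the variance vanishes and the truncation at `1` takes over.
Hence `Zstar` does not depend on the policies supplied to it. -/
theorem truncVar_unit (G : MarkovGame Unit A B H) (h : Fin H) (V : Unit → ℝ) (s : Unit) (a : A)
    (b : B) : truncVar G h V s a b = 1 := by
  simp [truncVar, transition_unit]

variable [Fintype A] [Fintype B]

theorem sum_pathProb_unit_smul {E : Type*} [AddCommGroup E] [Module ℝ E]
    (G : MarkovGame Unit A B H) {ξ : Unit → ℝ} (hξ : ξ () = 1)
    {σ : Fin H → Unit → A × B → ℝ} (hσ : ∀ t, ∑ ab, σ t () ab = 1) {h : ℕ} (t : Step H h)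
    (f : Unit × A × B → E) :
    ∑ p : Path Unit A B H h, pathProb G ξ σ h p • f (p t) = ∑ ab, σ t.1 () ab • f ((), ab) := by
  simp_rw [pathProb_unit G hξ]
  refine (sum_pi_prod_smul (fun (t : Step H h) (x : Unit × A × B) => σ t.1 () x.2)
    (fun t => ?_) t f).trans ?_
  · rw [Fintype.sum_prod_type]; simp [hσ]
  · rw [Fintype.sum_prod_type]; simp

theorem sum_pathProb_unit (G : MarkovGame Unit A B H) {ξ : Unit → ℝ} (hξ : ξ () = 1)
    {σ : Fin H → Unit → A × B → ℝ} (hσ : ∀ t, ∑ ab, σ t () ab = 1) {h : ℕ} :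
    ∑ p : Path Unit A B H h, pathProb G ξ σ h p = 1 := by
  simp_rw [pathProb_unit G hξ]
  refine sum_pi_prod_eq_one (fun (t : Step H h) (x : Unit × A × B) => σ t.1 () x.2) fun t => ?_
  rw [Fintype.sum_prod_type]; simp [hσ]

theorem expSum_unit (G : MarkovGame Unit A B H) {ξ : Unit → ℝ} (hξ : ξ () = 1)
    {σ : Fin H → Unit → A × B → ℝ} (hσ : ∀ t, ∑ ab, σ t () ab = 1) (h : ℕ)
    (f : Fin H → Unit → A → B → ℝ) :
    expSum G ξ σ h f = ∑ t : Step H h, ∑ ab : A × B, σ t.1 () ab * f t.1 () ab.1 ab.2 := by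
  unfold expSum
  simp_rw [Finset.mul_sum]
  rw [Finset.sum_comm]
  exact Finset.sum_congr rfl fun t _ =>
    sum_pathProb_unit_smul G hξ hσ t fun x => f t.1 x.1 x.2.1 x.2.2

theorem sum_jointPolicy {S : Type} (π : Policy S A H) (ν : Policy S B H) (t : Fin H) (s : S) :
    ∑ ab, jointPolicy π ν t s ab = 1 := by
  unfold jointPolicy
  rw [Fintype.sum_prod_type]
  simp_rw [← Finset.mul_sum]
  rw [(ν t s).2.2]
  simpa using (π t s).2.2

theorem simplex_unit (ξ : stdSimplex ℝ Unit) : ξ.1 () = 1 := by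
  simpa using ξ.2.2

instance isProbabilityMeasure_trajectoryLaw_unit (G : MarkovGame Unit A B H)
    (ξ : stdSimplex ℝ Unit) (β : Fin H → Unit → stdSimplex ℝ (A × B)) :
    IsProbabilityMeasure (trajectoryLaw G ξ β) := by
  classical
  constructor
  have h := trajectoryLaw_apply G ξ β Set.univ
  simp only [Set.preimage_univ, Set.mem_univ, if_true, mul_one] at h
  rw [h, sum_pathProb_unit G (simplex_unit ξ) fun t => (β t ()).2.2, ENNReal.ofReal_one]

theorem featureCov_unit (G : MarkovGame Unit A B H) (φ : Unit → A → B → EuclideanSpace ℝ (Fin d))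
    (ξ : stdSimplex ℝ Unit) (β : Fin H → Unit → stdSimplex ℝ (A × B)) (h : Step H 0) :
    featureCov G φ ξ β h = ∑ ab : A × B, (β h.1 ()).1 ab •
      Matrix.vecMulVec (φ () ab.1 ab.2).ofLp (φ () ab.1 ab.2).ofLp :=
  sum_pathProb_unit_smul G (simplex_unit ξ) (fun t => (β t ()).2.2) h
    fun x => Matrix.vecMulVec (φ x.1 x.2.1 x.2.2).ofLp (φ x.1 x.2.1 x.2.2).ofLp

end OneState

/-! ### A dual bound for the elliptical norm. -/

/-- If `Z` dominates `n ∑ⱼ φⱼ φⱼᵀ` and `v = ∑ⱼ cⱼ φⱼ`, then `‖v‖²_{Z⁻¹} ≤ (∑ⱼ cⱼ²) / n`. -/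
theorem invNorm_le_of_sum_smul {ι : Type*} [Fintype ι] {d : ℕ} {Z : Matrix (Fin d) (Fin d) ℝ}
    (hZ : IsUnit Z) (φ : ι → Fin d → ℝ) {n : ℝ} (hn : 0 < n)
    (hdom : ∀ w : Fin d → ℝ, n * ∑ j, (φ j ⬝ᵥ w) ^ 2 ≤ w ⬝ᵥ Z *ᵥ w)
    (c : ι → ℝ) {v : EuclideanSpace ℝ (Fin d)} (hv : v.ofLp = ∑ j, c j • φ j) :
    invNorm Z v ≤ √((∑ j, c j ^ 2) / n) := by
  refine Real.sqrt_le_sqrt ?_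
  set w := Z⁻¹ *ᵥ v.ofLp with hw
  have hZw : Z *ᵥ w = v.ofLp := by
    rw [hw, Matrix.mulVec_mulVec, Matrix.mul_nonsing_inv _ ((Matrix.isUnit_iff_isUnit_det Z).1 hZ),
      Matrix.one_mulVec]
  set q := v.ofLp ⬝ᵥ w with hq
  have hd : n * ∑ j, (φ j ⬝ᵥ w) ^ 2 ≤ q := by
    have := hdom w
    rwa [hZw, dotProduct_comm w] at this
  have hqs : q = ∑ j, c j * (φ j ⬝ᵥ w) := by
    rw [hq, hv, sum_dotProduct]
    simp [smul_dotProduct]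
  -- Since `q = vᵀ Z⁻¹ v = wᵀ Z w`, domination bounds the last sum by `q / n`. Cauchy–Schwarz thus
  -- gives `q² ≤ (∑ c²) q / n`, and one factor `q` cancels unless it is zero.
  have hcs : q ^ 2 ≤ (∑ j, c j ^ 2) * ∑ j, (φ j ⬝ᵥ w) ^ 2 := by
    rw [hqs]; exact Finset.sum_mul_sq_le_sq_mul_sq _ _ _
  have hs0 : 0 ≤ ∑ j, (φ j ⬝ᵥ w) ^ 2 := Finset.sum_nonneg fun j _ => sq_nonneg _
  have hc0 : 0 ≤ ∑ j, c j ^ 2 := Finset.sum_nonneg fun j _ => sq_nonneg _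
  have hq0 : 0 ≤ q := (mul_nonneg hn.le hs0).trans hd
  rw [le_div_iff₀ hn]
  rcases hq0.eq_or_lt with h | h
  · rw [← h]; simpa using hc0
  · refine le_of_mul_le_mul_left ?_ h
    nlinarith [mul_le_mul_of_nonneg_left hd hc0]

/-- The value `±1` of a Boolean. -/
def boolSign (b : Bool) : ℝ := if b then 1 else -1

@[simp] theorem boolSign_true : boolSign true = 1 := rfl

@[simp] theorem boolSign_false : boolSign false = -1 := rfl

@[simp] theorem boolSign_not (b : Bool) : boolSign (!b) = -boolSign b := by cases b <;> simp

@[simp] theorem boolSign_mul_self (b : Bool) : boolSign b * boolSign b = 1 := by cases b <;> simp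

@[simp] theorem abs_boolSign (b : Bool) : |boolSign b| = 1 := by cases b <;> simp

/-! ### The hypercube of sign games: values, equilibria, linearity. -/

section SignGame

variable {k H : ℕ}

/-- Half the difference `(a - b) / 2` of two sign vectors. -/
noncomputable def halfDiff (a b : Fin k → Bool) (i : Fin k) : ℝ :=
  (boolSign (a i) - boolSign (b i)) / 2

theorem abs_halfDiff_le (a b : Fin k → Bool) (i : Fin k) : |halfDiff a b i| ≤ 1 := by
  unfold halfDiff
  cases a i <;> cases b i <;> norm_num

theorem halfDiff_sq_le (a b : Fin k → Bool) (i : Fin k) : halfDiff a b i ^ 2 ≤ 1 :=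
  (sq_le_one_iff_abs_le_one _).2 (abs_halfDiff_le a b i)

/-- The feature map `φ(a, b) = (1, (a - b) / (2 √k)) / √2`. -/
noncomputable def signFeature (k : ℕ) (_ : Unit) (a b : Fin k → Bool) :
    EuclideanSpace ℝ (Fin (k + 1)) :=
  WithLp.toLp 2 (Fin.cons (√2)⁻¹ fun i => halfDiff a b i * (√(2 * k))⁻¹)

theorem abs_sum_boolSign_mul_halfDiff_le (θ a b : Fin k → Bool) :
    |∑ i, boolSign (θ i) * halfDiff a b i| ≤ k := by
  refine (Finset.abs_sum_le_sum_abs _ _).trans ?_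
  calc ∑ i, |boolSign (θ i) * halfDiff a b i| ≤ ∑ _i : Fin k, (1 : ℝ) :=
        Finset.sum_le_sum fun i _ => by
          rw [abs_mul, abs_boolSign, one_mul]; exact abs_halfDiff_le a b i
    _ = k := by simp

/-- The one-state game in which, at each step, the players choose sign vectors `a, b ∈ {±1}^k` and
the mean reward is `1 / 2 + Δ ⟨θ_h, (a - b) / 2⟩` for the unknown sign vectors `θ_h`. -/
noncomputable def signGame {Δ : ℝ} (hΔ : 0 ≤ Δ) (hΔk : Δ * k ≤ 1 / 2)
    (θ : Fin H → Fin k → Bool) : MarkovGame Unit (Fin k → Bool) (Fin k → Bool) H where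
  P _ _ _ _ := ⟨fun _ => 1, fun _ => zero_le_one, by simp⟩
  r h _ a b := 1 / 2 + Δ * ∑ i, boolSign (θ h i) * halfDiff a b i
  r_mem h _ a b := by
    have h1 := abs_le.1 (abs_sum_boolSign_mul_halfDiff_le (θ h) a b)
    constructor <;> nlinarith [h1.1, h1.2]

/-- The pair of actions with `(a - b) / 2 = ± e_i`. -/
def probe (j : Fin k × Bool) : (Fin k → Bool) × (Fin k → Bool) :=
  (Function.update (fun _ => true) j.1 j.2, Function.update (fun _ => true) j.1 (!j.2))

theorem halfDiff_probe (j : Fin k × Bool) (i : Fin k) :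
    halfDiff (probe j).1 (probe j).2 i = if i = j.1 then boolSign j.2 else 0 := by
  unfold halfDiff probe
  by_cases h : i = j.1
  · subst h; simp
  · simp [h]

theorem probe_injective : Function.Injective (probe (k := k)) := by
  rintro ⟨i, s⟩ ⟨i', s'⟩ h
  have h1 := halfDiff_probe (i, s) i
  rw [h, halfDiff_probe] at h1
  simp only [if_true] at h1
  split_ifs at h1 with hi
  · subst hi
    cases s <;> cases s' <;> simp at h1 ⊢ <;> norm_num at h1
  · cases s <;> simp at h1

/-- The behavior policy: uniform on the probing pairs. -/
noncomputable def probePolicy (hk : 0 < k) :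
    stdSimplex ℝ ((Fin k → Bool) × (Fin k → Bool)) :=
  ⟨fun ab => ∑ j : Fin k × Bool, if probe j = ab then (2 * k : ℝ)⁻¹ else 0,
    fun ab => Finset.sum_nonneg fun j _ => by split_ifs <;> positivity, by
      rw [Finset.sum_comm]
      have : (k : ℝ) ≠ 0 := by positivity
      simp
      field_simp⟩

theorem sum_probePolicy_smul {E : Type*} [AddCommGroup E] [Module ℝ E] (hk : 0 < k)
    (f : (Fin k → Bool) × (Fin k → Bool) → E) :
    ∑ ab, (probePolicy hk).1 ab • f ab = (2 * k : ℝ)⁻¹ • ∑ j, f (probe j) := by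
  simp only [probePolicy, Finset.sum_smul]
  rw [Finset.sum_comm, Finset.smul_sum]
  refine Finset.sum_congr rfl fun j _ => ?_
  simp [ite_smul]

/-- The mean of the `i`-th sign under a mixed action. -/
noncomputable def meanSign (q : stdSimplex ℝ (Fin k → Bool)) (i : Fin k) : ℝ :=
  ∑ a, q.1 a * boolSign (a i)

theorem abs_meanSign_le (q : stdSimplex ℝ (Fin k → Bool)) (i : Fin k) : |meanSign q i| ≤ 1 := by
  unfold meanSign
  refine (Finset.abs_sum_le_sum_abs _ _).trans ?_
  rw [← q.2.2]
  refine Finset.sum_le_sum fun a _ => ?_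
  rw [abs_mul, abs_boolSign, mul_one, abs_of_nonneg (q.2.1 a)]

theorem boolSign_mul_meanSign_le (q : stdSimplex ℝ (Fin k → Bool)) (i : Fin k) (s : Bool) :
    boolSign s * meanSign q i ≤ 1 := by
  refine (le_abs_self _).trans ?_
  rw [abs_mul, abs_boolSign, one_mul]
  exact abs_meanSign_le q i

/-- The policy that plays the sign vectors `θ`. -/
noncomputable def purePolicy (θ : Fin H → Fin k → Bool) : Policy Unit (Fin k → Bool) H :=
  fun h _ => ⟨Pi.single (θ h) 1, single_mem_stdSimplex ℝ (θ h)⟩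

theorem meanSign_purePolicy (θ : Fin H → Fin k → Bool) (h : Fin H) (s : Unit) (i : Fin k) :
    meanSign (purePolicy θ h s) i = boolSign (θ h i) := by
  simp [meanSign, purePolicy, Pi.single_apply]

/-- A separable payoff sees only the two marginals; this decouples the players in `value_signGame`.
-/
theorem sum_mul_add_of_simplex {A B : Type*} [Fintype A] [Fintype B] (p : stdSimplex ℝ A)
    (q : stdSimplex ℝ B) (f : A → ℝ) (g : B → ℝ) :
    ∑ ab : A × B, p.1 ab.1 * q.1 ab.2 * (f ab.1 + g ab.2) =
      ∑ a, p.1 a * f a + ∑ b, q.1 b * g b := by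
  have h : ∀ ab : A × B, p.1 ab.1 * q.1 ab.2 * (f ab.1 + g ab.2) =
      (p.1 ab.1 * f ab.1) * q.1 ab.2 + p.1 ab.1 * (q.1 ab.2 * g ab.2) := fun ab => by ring
  simp_rw [h]
  rw [Finset.sum_add_distrib, Fintype.sum_prod_type, Fintype.sum_prod_type]
  simp_rw [← Finset.mul_sum, ← Finset.sum_mul]
  have hp : ∑ a, p.1 a = 1 := p.2.2
  have hq : ∑ b, q.1 b = 1 := q.2.2
  rw [hp, hq, one_mul, mul_one]

variable {Δ : ℝ} (hΔ : 0 ≤ Δ) (hΔk : Δ * k ≤ 1 / 2)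

theorem value_signGame (θ : Fin H → Fin k → Bool) (π ν : Policy Unit (Fin k → Bool) H)
    (h : ℕ) (x : Unit) :
    value (signGame hΔ hΔk θ) π ν h x = ∑ t : Step H h, (1 / 2 + Δ / 2 * ∑ i,
      boolSign (θ t.1 i) * (meanSign (π t.1 ()) i - meanSign (ν t.1 ()) i)) := by
  unfold value
  rw [expSum_unit _ (by simp) (fun t => sum_jointPolicy π ν t ())]
  refine Finset.sum_congr rfl fun t _ => ?_
  have h1 : ∀ ab : (Fin k → Bool) × (Fin k → Bool),
      jointPolicy π ν t.1 () ab * (signGame hΔ hΔk θ).r t.1 () ab.1 ab.2 =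
      (π t.1 ()).1 ab.1 * (ν t.1 ()).1 ab.2 *
        ((1 / 2 + Δ / 2 * ∑ i, boolSign (θ t.1 i) * boolSign (ab.1 i)) +
          (-(Δ / 2) * ∑ i, boolSign (θ t.1 i) * boolSign (ab.2 i))) := by
    intro ab
    simp only [jointPolicy, signGame, halfDiff]
    congr 1
    rw [add_assoc, neg_mul, ← sub_eq_add_neg, ← mul_sub, ← Finset.sum_sub_distrib,
      div_mul_eq_mul_div, mul_div_assoc, Finset.sum_div]
    congr 2
    refine Finset.sum_congr rfl fun i _ => ?_
    ring
  simp_rw [h1]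
  rw [sum_mul_add_of_simplex (π t.1 ()) (ν t.1 ())
    (fun a => 1 / 2 + Δ / 2 * ∑ i, boolSign (θ t.1 i) * boolSign (a i))
    (fun b => -(Δ / 2) * ∑ i, boolSign (θ t.1 i) * boolSign (b i))]
  have hlin : ∀ (q : stdSimplex ℝ (Fin k → Bool)) (c : ℝ),
      ∑ a, q.1 a * (c * ∑ i, boolSign (θ t.1 i) * boolSign (a i)) =
        c * ∑ i, boolSign (θ t.1 i) * meanSign q i := by
    intro q c
    simp only [meanSign, Finset.mul_sum]
    rw [Finset.sum_comm]
    refine Finset.sum_congr rfl fun i _ => Finset.sum_congr rfl fun a _ => ?_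
    ring
  have hsum : ∑ a, (π t.1 ()).1 a = 1 := (π t.1 ()).2.2
  simp_rw [mul_add]
  rw [Finset.sum_add_distrib, hlin, hlin, ← Finset.sum_mul, hsum]
  simp_rw [mul_sub, Finset.sum_sub_distrib]
  ring

/-- Dominance: `θ` is optimal against every `ν`. This yields the equilibrium and also the
best-response value in the duality gap. -/
theorem value_signGame_le_purePolicy (θ : Fin H → Fin k → Bool)
    (π ν : Policy Unit (Fin k → Bool) H) (h : ℕ) (x : Unit) :
    value (signGame hΔ hΔk θ) π ν h x ≤ value (signGame hΔ hΔk θ) (purePolicy θ) ν h x := by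
  rw [value_signGame, value_signGame]
  simp_rw [mul_sub, meanSign_purePolicy, boolSign_mul_self]
  gcongr
  exact boolSign_mul_meanSign_le _ _ _

theorem value_signGame_purePolicy_le (θ : Fin H → Fin k → Bool)
    (π ν : Policy Unit (Fin k → Bool) H) (h : ℕ) (x : Unit) :
    value (signGame hΔ hΔk θ) π (purePolicy θ) h x ≤ value (signGame hΔ hΔk θ) π ν h x := by
  rw [value_signGame, value_signGame]
  simp_rw [mul_sub, meanSign_purePolicy, boolSign_mul_self]
  gcongr
  exact boolSign_mul_meanSign_le _ _ _

theorem isNash_signGame (θ : Fin H → Fin k → Bool) :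
    IsNash (signGame hΔ hΔk θ) (purePolicy θ) (purePolicy θ) :=
  ⟨fun π' h x => value_signGame_le_purePolicy hΔ hΔk θ π' _ h x,
    fun ν' h x => value_signGame_purePolicy_le hΔ hΔk θ _ ν' h x⟩

theorem dualityGap_signGame (θ : Fin H → Fin k → Bool) (π ν : Policy Unit (Fin k → Bool) H)
    (x : Unit) :
    dualityGap (signGame hΔ hΔk θ) π ν x = ∑ t : Step H 0, ∑ i, Δ / 2 *
      (2 - boolSign (θ t.1 i) * (meanSign (π t.1 ()) i + meanSign (ν t.1 ()) i)) := by
  have hsup : ⨆ π', value (signGame hΔ hΔk θ) π' ν 0 x =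
      value (signGame hΔ hΔk θ) (purePolicy θ) ν 0 x :=
    IsGreatest.csSup_eq ⟨⟨_, rfl⟩, by
      rintro _ ⟨π', rfl⟩; exact value_signGame_le_purePolicy hΔ hΔk θ π' ν 0 x⟩
  have hinf : ⨅ ν', value (signGame hΔ hΔk θ) π ν' 0 x =
      value (signGame hΔ hΔk θ) π (purePolicy θ) 0 x :=
    IsLeast.csInf_eq ⟨⟨_, rfl⟩, by
      rintro _ ⟨ν', rfl⟩; exact value_signGame_purePolicy_le hΔ hΔk θ π ν' 0 x⟩
  rw [dualityGap, hsup, hinf, value_signGame, value_signGame, ← Finset.sum_sub_distrib]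
  refine Finset.sum_congr rfl fun t _ => ?_
  rw [add_sub_add_left_eq_sub, ← mul_sub, ← Finset.sum_sub_distrib, Finset.mul_sum]
  refine Finset.sum_congr rfl fun i _ => ?_
  rw [meanSign_purePolicy]
  linear_combination Δ * boolSign_mul_self (θ t.1 i)

theorem isLinear_signGame (hk : 0 < k) (θ : Fin H → Fin k → Bool) :
    IsLinear (signGame hΔ hΔk θ) (signFeature k) := by
  have hk' : (0 : ℝ) < k := by exact_mod_cast hk
  have hs2 : √2 * √2 = (2 : ℝ) := Real.mul_self_sqrt (by norm_num)
  have hs2k : √(2 * k) * √(2 * k) = (2 * k : ℝ) := Real.mul_self_sqrt (by positivity)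
  have h2 : (√2 : ℝ) ≠ 0 := by positivity
  have h2k : √(2 * k : ℝ) ≠ 0 := by positivity
  -- The constant coordinate `1/√2` of the feature produces the transition mass `1` and the reward
  -- offset `1/2`. The squared norms are `2` and `1/2 + 2(Δk)² ≤ 1`, both at most `k + 1` because `k
  -- ≥ 1` and `Δk ≤ 1/2`.
  refine ⟨fun s a b => ?_, fun h => ⟨fun _ => WithLp.toLp 2 (Fin.cons (√2) fun _ => 0),
    WithLp.toLp 2 (Fin.cons (√2 / 2) fun i => Δ * √(2 * k) * boolSign (θ h i)),
    fun s a b => ⟨fun s' => ?_, ?_⟩, ?_, ?_⟩⟩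
  · rw [EuclideanSpace.norm_eq, Real.sqrt_le_one]
    simp only [signFeature, Fin.sum_univ_succ, Fin.cons_zero, Fin.cons_succ, Real.norm_eq_abs,
      sq_abs]
    have h1 : ∀ i : Fin k, (halfDiff a b i * (√(2 * k : ℝ))⁻¹) ^ 2 ≤ (2 * k : ℝ)⁻¹ := by
      intro i
      rw [mul_pow, inv_pow, sq √(2 * k : ℝ), hs2k]
      exact mul_le_of_le_one_left (by positivity) (halfDiff_sq_le a b i)
    have h3 := Finset.sum_le_sum fun i (_ : i ∈ Finset.univ) => h1 i
    rw [Finset.sum_const, Finset.card_univ, Fintype.card_fin, nsmul_eq_mul] at h3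
    have h4 : (k : ℝ) * (2 * k : ℝ)⁻¹ = 1 / 2 := by field_simp
    have h5 : (√2 : ℝ)⁻¹ ^ 2 = 1 / 2 := by rw [inv_pow, sq, hs2]; norm_num
    linarith
  · simp [signGame, signFeature, PiLp.inner_apply, Fin.sum_univ_succ, h2]
  · simp only [signGame, signFeature, PiLp.inner_apply, Fin.sum_univ_succ, Fin.cons_zero,
      Fin.cons_succ, RCLike.inner_apply, conj_trivial]
    congr 1
    · field_simp
    · rw [Finset.mul_sum]
      refine Finset.sum_congr rfl fun i _ => ?_
      field_simp
  · simp only [Finset.univ_unique, Finset.sum_singleton, EuclideanSpace.norm_eq]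
    refine Real.sqrt_le_sqrt ?_
    simp [Fin.sum_univ_succ]
    have : (1 : ℝ) ≤ k := by exact_mod_cast hk
    linarith
  · rw [EuclideanSpace.norm_eq]
    refine Real.sqrt_le_sqrt ?_
    simp only [Fin.sum_univ_succ, Fin.cons_zero, Fin.cons_succ, Real.norm_eq_abs, sq_abs]
    have h1 : ∀ i : Fin k, (Δ * √(2 * k) * boolSign (θ h i)) ^ 2 = Δ ^ 2 * (2 * k) := by
      intro i
      rw [mul_pow, mul_pow, sq √(2 * k : ℝ), hs2k, sq (boolSign _), boolSign_mul_self, mul_one]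
    simp_rw [h1]
    rw [Finset.sum_const, Finset.card_univ, Fintype.card_fin, nsmul_eq_mul, div_pow, sq √2, hs2]
    have h3 : 0 ≤ Δ * k := by positivity
    push_cast
    nlinarith

end SignGame

/-! ### Coverage by the probing pairs and the upper bound on the complexity. -/

section Coverage

variable {k H K : ℕ}

theorem sum_prod_bool (f : Fin k × Bool → ℝ) :
    ∑ j, f j = ∑ i, (f (i, true) + f (i, false)) := by
  rw [Fintype.sum_prod_type]
  simp

/-- The coefficients of a feature vector in the features of the probing pairs. -/
noncomputable def probeCoeff (a b : Fin k → Bool) (j : Fin k × Bool) : ℝ :=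
  ((k : ℝ)⁻¹ + boolSign j.2 * halfDiff a b j.1) / 2

/-- For each `i`, the coefficients of `(i, true)` and `(i, false)` have sum `1/k`, which builds the
constant coordinate, and difference `halfDiff a b i`, which builds coordinate `i`. -/
theorem signFeature_eq_sum_probe (hk : 0 < k) (a b : Fin k → Bool) :
    (signFeature k () a b).ofLp =
      ∑ j, probeCoeff a b j • (signFeature k () (probe j).1 (probe j).2).ofLp := by
  have hk' : (k : ℝ) ≠ 0 := by positivity
  funext l
  rw [Finset.sum_apply, sum_prod_bool]
  refine Fin.cases ?_ (fun i => ?_) l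
  · simp only [signFeature, probeCoeff, Pi.smul_apply, Fin.cons_zero, smul_eq_mul, boolSign_true,
      boolSign_false, ← add_mul]
    rw [← Finset.sum_mul]
    have : ∀ i : Fin k, ((k : ℝ)⁻¹ + 1 * halfDiff a b i) / 2 +
        ((k : ℝ)⁻¹ + -1 * halfDiff a b i) / 2 = (k : ℝ)⁻¹ := fun i => by ring
    simp_rw [this]
    simp [hk']
  · simp only [signFeature, Pi.smul_apply, Fin.cons_succ, smul_eq_mul, halfDiff_probe]
    rw [Finset.sum_eq_single i]
    · simp only [probeCoeff, if_true, boolSign_true, boolSign_false]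
      ring
    · intro j _ hj
      simp [hj.symm]
    · simp

theorem sum_probeCoeff_sq_le (hk : 0 < k) (a b : Fin k → Bool) :
    ∑ j, probeCoeff a b j ^ 2 ≤ k := by
  have hk' : (1 : ℝ) ≤ k := by exact_mod_cast hk
  rw [sum_prod_bool]
  calc _ ≤ ∑ _i : Fin k, (1 : ℝ) := by
        refine Finset.sum_le_sum fun i _ => ?_
        simp only [probeCoeff, boolSign_true, boolSign_false]
        have h1 := halfDiff_sq_le a b i
        have h2 : (k : ℝ)⁻¹ ≤ 1 := inv_le_one_of_one_le₀ hk'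
        have h3 : 0 ≤ (k : ℝ)⁻¹ := by positivity
        nlinarith
    _ = k := by simp

theorem posDef_featureCov_probePolicy (hk : 0 < k)
    (G : MarkovGame Unit (Fin k → Bool) (Fin k → Bool) H) (ξ : stdSimplex ℝ Unit)
    (h : Step H 0) :
    (featureCov G (signFeature k) ξ (fun _ _ => probePolicy hk) h).PosDef := by
  have hk' : (0 : ℝ) < k := by exact_mod_cast hk
  rw [featureCov_unit, sum_probePolicy_smul hk
    fun ab => Matrix.vecMulVec (signFeature k () ab.1 ab.2).ofLp (signFeature k () ab.1 ab.2).ofLp]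
  refine Matrix.PosDef.smul ?_ (by positivity)
  refine Matrix.PosDef.of_dotProduct_mulVec_pos ?_ fun w hw => ?_
  · rw [Matrix.IsHermitian, Matrix.conjTranspose_sum]
    refine Finset.sum_congr rfl fun j _ => ?_
    rw [Matrix.conjTranspose_vecMulVec]
    simp
  · have hquad : star w ⬝ᵥ (∑ j, Matrix.vecMulVec
        (signFeature k () (probe j).1 (probe j).2).ofLp
        (signFeature k () (probe j).1 (probe j).2).ofLp) *ᵥ w =
        ∑ j : Fin k × Bool, ((signFeature k () (probe j).1 (probe j).2).ofLp ⬝ᵥ w) ^ 2 := by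
      rw [Matrix.sum_mulVec, dotProduct_sum]
      refine Finset.sum_congr rfl fun j _ => ?_
      rw [Matrix.vecMulVec_mulVec, star_trivial]
      simp [dotProduct_comm w, sq]
    rw [hquad]
    refine lt_of_le_of_ne (Finset.sum_nonneg fun j _ => sq_nonneg _) fun h0 => hw ?_
    have hz : ∀ j : Fin k × Bool, (signFeature k () (probe j).1 (probe j).2).ofLp ⬝ᵥ w = 0 :=
      fun j => pow_eq_zero_iff (two_ne_zero) |>.1
        ((Finset.sum_eq_zero_iff_of_nonneg fun j _ => sq_nonneg _).1 h0.symm j (Finset.mem_univ j))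
    -- Adding the equations for the two signs isolates the constant coordinate of `w`; subtracting
    -- them isolates coordinate `i`.
    have hz' : ∀ (i : Fin k) (s : Bool),
        (√2)⁻¹ * w 0 + boolSign s * (√(2 * k))⁻¹ * w i.succ = 0 := by
      intro i s
      have := hz (i, s)
      simp only [signFeature, dotProduct, Fin.sum_univ_succ, Fin.cons_zero, Fin.cons_succ,
        halfDiff_probe] at this
      rw [Finset.sum_eq_single i] at this
      · simpa using this
      · intro j _ hj; simp [hj]
      · simp
    have h2 : (√2 : ℝ)⁻¹ ≠ 0 := by positivity
    have h2k : (√(2 * k : ℝ))⁻¹ ≠ 0 := by positivity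
    funext l
    refine Fin.cases ?_ (fun i => ?_) l
    · have e1 := hz' ⟨0, hk⟩ true
      have e2 := hz' ⟨0, hk⟩ false
      simp only [boolSign_true, boolSign_false] at e1 e2
      have : (√2)⁻¹ * w 0 = 0 := by linarith
      simpa using (mul_eq_zero.1 this).resolve_left h2
    · have e1 := hz' i true
      have e2 := hz' i false
      simp only [boolSign_true, boolSign_false] at e1 e2
      have : (√(2 * k))⁻¹ * w i.succ = 0 := by linarith
      exact (mul_eq_zero.1 this).resolve_left h2k

/-- The number of times the probing pair `j` is played at step `h` in the dataset. -/
def probeCount (D : Dataset Unit (Fin k → Bool) (Fin k → Bool) H K) (h : Step H 0)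
    (j : Fin k × Bool) : ℕ :=
  (Finset.univ.filter fun τ => ((D τ).1 h).2 = probe j).card

/-- Keeping only the samples at probing pairs, `Zstar` dominates `n` times the Gram matrix of the
probed features, so `invNorm_le_of_sum_smul` applies with the coefficients `probeCoeff`. -/
theorem invNorm_Zstar_le (hk : 0 < k) (G : MarkovGame Unit (Fin k → Bool) (Fin k → Bool) H)
    {reg : ℝ} (hreg : 0 < reg) (π ν : Policy Unit (Fin k → Bool) H)
    (D : Dataset Unit (Fin k → Bool) (Fin k → Bool) H K) (h : Fin H) {n : ℝ} (hn : 0 < n)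
    (hD : ∀ j, n ≤ probeCount D ⟨h, Nat.zero_le _⟩ j) (a b : Fin k → Bool) :
    invNorm (Zstar G (signFeature k) reg π ν D h) (signFeature k () a b) ≤ √(k / n) := by
  obtain ⟨act, hact⟩ : ∃ act : Fin K → (Fin k → Bool) × (Fin k → Bool),
      ∀ τ, act τ = ((D τ).1 ⟨h, Nat.zero_le _⟩).2 := ⟨_, fun _ => rfl⟩
  set ψ : Fin K → Fin (k + 1) → ℝ := fun τ => (signFeature k () (act τ).1 (act τ).2).ofLp
    with hψ
  have hD' : ∀ j, n ≤ (Finset.univ.filter fun τ => act τ = probe j).card := by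
    intro j
    simp_rw [hact]
    exact hD j
  have hZ : Zstar G (signFeature k) reg π ν D h =
      ∑ τ, Matrix.vecMulVec (ψ τ) (ψ τ) + reg • (1 : Matrix _ _ ℝ) := by
    simp [Zstar, truncVar_unit, hψ, hact]
  have hpd : (Zstar G (signFeature k) reg π ν D h).PosDef := by
    rw [hZ]
    refine Matrix.PosDef.posSemidef_add ?_ (Matrix.PosDef.one.smul hreg)
    refine Matrix.posSemidef_sum _ fun τ _ => ?_
    simpa using Matrix.posSemidef_vecMulVec_self_star (ψ τ)
  refine (invNorm_le_of_sum_smul hpd.isUnit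
    (fun j => (signFeature k () (probe j).1 (probe j).2).ofLp) hn (fun w => ?_) (probeCoeff a b)
    (signFeature_eq_sum_probe hk a b)).trans
    (Real.sqrt_le_sqrt (by gcongr; exact sum_probeCoeff_sq_le hk a b))
  have hquad : w ⬝ᵥ Zstar G (signFeature k) reg π ν D h *ᵥ w =
      ∑ τ, (ψ τ ⬝ᵥ w) ^ 2 + reg * (w ⬝ᵥ w) := by
    rw [hZ, Matrix.add_mulVec, dotProduct_add, Matrix.sum_mulVec, dotProduct_sum,
      Matrix.smul_mulVec, Matrix.one_mulVec, dotProduct_smul, smul_eq_mul]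
    congr 1
    refine Finset.sum_congr rfl fun τ _ => ?_
    rw [Matrix.vecMulVec_mulVec]
    simp [dotProduct_comm w, sq]
  have hww : 0 ≤ w ⬝ᵥ w := Finset.sum_nonneg fun i _ => mul_self_nonneg _
  rw [hquad, Finset.mul_sum]
  have hcount : ∑ j, n * ((signFeature k () (probe j).1 (probe j).2).ofLp ⬝ᵥ w) ^ 2 ≤
      ∑ j, ∑ τ, if act τ = probe j then (ψ τ ⬝ᵥ w) ^ 2 else 0 := by
    refine Finset.sum_le_sum fun j _ => ?_
    have h1 : ∀ τ, (if act τ = probe j then (ψ τ ⬝ᵥ w) ^ 2 else 0) =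
        if act τ = probe j then
          ((signFeature k () (probe j).1 (probe j).2).ofLp ⬝ᵥ w) ^ 2 else 0 := by
      intro τ
      split_ifs with hτ
      · simp only [hψ, hτ]
      · rfl
    simp_rw [h1]
    rw [← Finset.sum_filter, Finset.sum_const, nsmul_eq_mul]
    gcongr
    exact hD' j
  have hswap : ∑ j, ∑ τ, (if act τ = probe j then
      (ψ τ ⬝ᵥ w) ^ 2 else 0) ≤ ∑ τ, (ψ τ ⬝ᵥ w) ^ 2 := by
    rw [Finset.sum_comm]
    refine Finset.sum_le_sum fun τ _ => ?_
    rw [← Finset.sum_filter, Finset.sum_const, nsmul_eq_mul]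
    refine mul_le_of_le_one_left (sq_nonneg _) ?_
    -- Distinct probes are distinct action pairs, so no sample is counted twice.
    have hcard : (Finset.univ.filter fun j => act τ = probe j).card ≤ 1 :=
      Finset.card_le_one.2 fun j hj j' hj' => probe_injective
        ((Finset.mem_filter.1 hj).2.symm.trans (Finset.mem_filter.1 hj').2)
    exact_mod_cast hcard
  nlinarith [mul_nonneg hreg.le hww]

instance (S A : Type) [Fintype A] [Nonempty A] (H : ℕ) : Nonempty (Policy S A H) := by
  classical
  exact ⟨fun _ _ => ⟨Pi.single (Classical.arbitrary A) 1, single_mem_stdSimplex ℝ _⟩⟩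

theorem card_step_zero (H : ℕ) : Fintype.card (Step H 0) = H := by
  rw [Fintype.card_of_bijective (f := fun t : Step H 0 => t.1)
    ⟨Subtype.val_injective, fun t => ⟨⟨t, Nat.zero_le _⟩, rfl⟩⟩, Fintype.card_fin]

theorem expSum_unit_le {A B : Type} [Fintype A] [Fintype B] (G : MarkovGame Unit A B H)
    (ξ : stdSimplex ℝ Unit) (π : Policy Unit A H) (ν : Policy Unit B H)
    {f : Fin H → Unit → A → B → ℝ} {c : ℝ} (hf : ∀ h a b, f h () a b ≤ c) :
    expSum G ξ.1 (jointPolicy π ν) 0 f ≤ H * c := by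
  rw [expSum_unit G (simplex_unit ξ) fun t => sum_jointPolicy π ν t ()]
  calc _ ≤ ∑ _t : Step H 0, c := by
        refine Finset.sum_le_sum fun t _ => ?_
        calc _ ≤ ∑ ab, jointPolicy π ν t.1 () ab * c := by
              refine Finset.sum_le_sum fun ab _ => mul_le_mul_of_nonneg_left (hf _ _ _) ?_
              exact mul_nonneg ((π t.1 ()).2.1 _) ((ν t.1 ()).2.1 _)
          _ = c := by rw [← Finset.sum_mul, sum_jointPolicy, one_mul]
    _ = H * c := by
        rw [Finset.sum_const, Finset.card_univ, nsmul_eq_mul,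
          card_step_zero]

/-- The elliptical norm is bounded uniformly over actions, so the deviating policies in the two
suprema play no role. -/
theorem complexity_le (hk : 0 < k) (G : MarkovGame Unit (Fin k → Bool) (Fin k → Bool) H)
    (ξ : stdSimplex ℝ Unit)
    {reg : ℝ} (hreg : 0 < reg) (π ν : Policy Unit (Fin k → Bool) H)
    (D : Dataset Unit (Fin k → Bool) (Fin k → Bool) H K) {n : ℝ} (hn : 0 < n)
    (hD : ∀ h j, n ≤ probeCount D h j) :
    complexity G (signFeature k) reg ξ π ν D ≤ 2 * (H * √(k / n)) := by
  have hinv : ∀ h a b,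
      invNorm (Zstar G (signFeature k) reg π ν D h) (signFeature k () a b) ≤ √(k / n) :=
    fun h a b => invNorm_Zstar_le hk G hreg π ν D h hn (fun j => hD _ j) a b
  rw [complexity, two_mul]
  refine add_le_add (ciSup_le fun ν' => ?_) (ciSup_le fun π' => ?_)
  · exact expSum_unit_le G ξ π ν' hinv
  · exact expSum_unit_le G ξ π' ν hinv

theorem measureReal_probeCount_le (hk : 0 < k)
    (G : MarkovGame Unit (Fin k → Bool) (Fin k → Bool) H) (ξ : stdSimplex ℝ Unit)
    (h : Step H 0) (j : Fin k × Bool) :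
    (datasetLaw G ξ (fun _ _ => probePolicy hk) K).real
      {D | (probeCount D h j : ℝ) ≤ K * (2 * k : ℝ)⁻¹ / 2} ≤
      Real.exp (-(K * (2 * k : ℝ)⁻¹ / 10)) := by
  classical
  let E : Set (Path Unit (Fin k → Bool) (Fin k → Bool) H 0) := {p | (p h).2 = probe j}
  have hsum : ∑ p : Path Unit (Fin k → Bool) (Fin k → Bool) H 0,
      pathProb G ξ.1 (fun _ _ => (probePolicy hk).1) 0 p * (if p ∈ E then 1 else 0) =
      (2 * k : ℝ)⁻¹ * ∑ j', if probe j' = probe j then 1 else 0 := by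
    rw [← smul_eq_mul, ← sum_probePolicy_smul hk fun ab => if ab = probe j then (1 : ℝ) else 0]
    rw [← sum_pathProb_unit_smul G (simplex_unit ξ) (σ := fun _ _ => (probePolicy hk).1)
      (fun t => (probePolicy hk).2.2) h fun x => if x.2 = probe j then (1 : ℝ) else 0]
    refine Finset.sum_congr rfl fun p _ => ?_
    rw [smul_eq_mul]
    congr 1
  have hone : (1 : ℝ) ≤ ∑ j', if probe j' = probe j then 1 else 0 := by
    have := Finset.single_le_sum (f := fun j' => if probe j' = probe j then (1 : ℝ) else 0)
      (fun j' _ => by split_ifs <;> simp) (Finset.mem_univ j)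
    simpa using this
  have hp : (2 * k : ℝ)⁻¹ ≤
      (trajectoryLaw G ξ fun _ _ => probePolicy hk).real (Prod.fst ⁻¹' E) := by
    rw [Measure.real, trajectoryLaw_apply, hsum, ENNReal.toReal_ofReal (by positivity)]
    exact le_mul_of_one_le_right (by positivity) hone
  have hE : MeasurableSet (Prod.fst ⁻¹' E :
      Set (Trajectory Unit (Fin k → Bool) (Fin k → Bool) H)) :=
    measurable_fst MeasurableSpace.measurableSet_top
  have hcard : ∀ D : Dataset Unit (Fin k → Bool) (Fin k → Bool) H K, probeCount D h j =
      (Finset.univ.filter fun τ => D τ ∈ (Prod.fst ⁻¹' E)).card := by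
    intro D
    unfold probeCount
    congr 1
    ext τ
    simp only [Finset.mem_filter]
    exact Iff.rfl
  simp_rw [hcard]
  exact measureReal_pi_count_le (trajectoryLaw G ξ fun _ _ => probePolicy hk) K hE hp

end Coverage

/-! ### Assouad's argument over the hidden signs. -/

section LowerBound

variable {k H K : ℕ}

/-- Flip the `i`-th sign at step `h`. -/
def flipSign (h : Fin H) (i : Fin k) (θ : Fin H → Fin k → Bool) : Fin H → Fin k → Bool :=
  fun t l => if t = h ∧ l = i then !(θ t l) else θ t l

theorem flipSign_self (h : Fin H) (i : Fin k) (θ : Fin H → Fin k → Bool) :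
    flipSign h i θ h i = !(θ h i) := by
  simp [flipSign]

theorem flipSign_involutive (h : Fin H) (i : Fin k) : Function.Involutive (flipSign h i) := by
  intro θ
  funext t l
  unfold flipSign
  split_ifs <;> simp

variable {Δ : ℝ} (hΔ : 0 ≤ Δ) (hΔk : Δ * k ≤ 1 / 2)

theorem signGame_flipSign_reward_sub_sq (h : Fin H) (i : Fin k) (θ : Fin H → Fin k → Bool)
    (t : Fin H) (x : Unit) (a b : Fin k → Bool) :
    ((signGame hΔ hΔk (flipSign h i θ)).r t x a b - (signGame hΔ hΔk θ).r t x a b) ^ 2 =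
      if t = h then 4 * Δ ^ 2 * halfDiff a b i ^ 2 else 0 := by
  simp only [signGame]
  rw [add_sub_add_left_eq_sub, ← mul_sub, ← Finset.sum_sub_distrib]
  by_cases ht : t = h
  · subst ht
    rw [if_pos rfl, Finset.sum_eq_single i]
    · rw [flipSign_self, boolSign_not]
      linear_combination (4 * Δ ^ 2 * halfDiff a b i ^ 2) * boolSign_mul_self (θ t i)
    · intro l _ hl
      simp [flipSign, hl]
    · simp
  · simp [flipSign, ht]

/-- A flip moves the reward by `±2Δ` on the two probes of coordinate `i` at step `h` and nowhere
else on the support of the behavior policy. These carry probability `1/k`, which makes gaps `Δ` of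
order `√(k/K)` undetectable. -/
theorem integral_likelihoodRatio_flipSign_sq (hk : 0 < k) (ξ : stdSimplex ℝ Unit) (h : Fin H)
    (i : Fin k) (θ : Fin H → Fin k → Bool) :
    ∫ z, likelihoodRatio (signGame hΔ hΔk θ) (signGame hΔ hΔk (flipSign h i θ)) z ^ 2
      ∂(trajectoryLaw (signGame hΔ hΔk θ) ξ fun _ _ => probePolicy hk) =
      1 + (Real.exp (4 * Δ ^ 2) - 1) / k := by
  have hk' : (k : ℝ) ≠ 0 := by positivity
  rw [integral_likelihoodRatio_sq]
  have hprod : ∀ p : Path Unit (Fin k → Bool) (Fin k → Bool) H 0,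
      ∏ t : Step H 0, Real.exp (((signGame hΔ hΔk (flipSign h i θ)).r t.1 (p t).1 (p t).2.1
        (p t).2.2 - (signGame hΔ hΔk θ).r t.1 (p t).1 (p t).2.1 (p t).2.2) ^ 2) =
      Real.exp (4 * Δ ^ 2 * halfDiff (p ⟨h, Nat.zero_le _⟩).2.1
        (p ⟨h, Nat.zero_le _⟩).2.2 i ^ 2) := by
    intro p
    rw [Finset.prod_eq_single (⟨h, Nat.zero_le _⟩ : Step H 0)]
    · rw [signGame_flipSign_reward_sub_sq, if_pos rfl]
    · intro t _ ht
      rw [signGame_flipSign_reward_sub_sq, if_neg fun h' => ht (Subtype.ext h'), Real.exp_zero]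
    · simp
  simp_rw [hprod]
  have hmarg := sum_pathProb_unit_smul (signGame hΔ hΔk θ) (simplex_unit ξ)
    (σ := fun _ _ => (probePolicy hk).1) (fun t => (probePolicy hk).2.2)
    (⟨h, Nat.zero_le _⟩ : Step H 0)
    fun x => Real.exp (4 * Δ ^ 2 * halfDiff x.2.1 x.2.2 i ^ 2)
  simp only [smul_eq_mul] at hmarg
  rw [hmarg]
  have hpr := sum_probePolicy_smul hk
    fun ab => Real.exp (4 * Δ ^ 2 * halfDiff ab.1 ab.2 i ^ 2)
  simp only [smul_eq_mul] at hpr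
  rw [hpr, sum_prod_bool]
  have hterm : ∀ l : Fin k,
      Real.exp (4 * Δ ^ 2 * halfDiff (probe (l, true)).1 (probe (l, true)).2 i ^ 2) +
      Real.exp (4 * Δ ^ 2 * halfDiff (probe (l, false)).1 (probe (l, false)).2 i ^ 2) =
      2 + if l = i then 2 * (Real.exp (4 * Δ ^ 2) - 1) else 0 := by
    intro l
    simp only [halfDiff_probe]
    by_cases hl : l = i
    · subst hl; simp; ring
    · rw [if_neg (Ne.symm hl), if_neg (Ne.symm hl), if_neg hl]; norm_num
  simp_rw [hterm]
  rw [Finset.sum_add_distrib, Finset.sum_ite_eq' Finset.univ i]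
  simp
  field_simp

/-- The sum of the mean signs of both players at step `h` and coordinate `i`. -/
noncomputable def totalMeanSign (h : Fin H) (i : Fin k)
    (σ : Policy Unit (Fin k → Bool) H × Policy Unit (Fin k → Bool) H) : ℝ :=
  meanSign (σ.1 h ()) i + meanSign (σ.2 h ()) i

theorem abs_totalMeanSign_le (h : Fin H) (i : Fin k)
    (σ : Policy Unit (Fin k → Bool) H × Policy Unit (Fin k → Bool) H) :
    |totalMeanSign h i σ| ≤ 2 := by
  refine (abs_add_le _ _).trans ?_
  linarith [abs_meanSign_le (σ.1 h ()) i, abs_meanSign_le (σ.2 h ()) i]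

theorem measurable_totalMeanSign (h : Fin H) (i : Fin k) :
    Measurable (totalMeanSign (k := k) (H := H) h i) := by
  have hm : ∀ a : Fin k → Bool, Measurable fun q : stdSimplex ℝ (Fin k → Bool) => q.1 a :=
    fun a => (measurable_pi_apply a).comp measurable_subtype_coe
  have hq : Measurable fun q : stdSimplex ℝ (Fin k → Bool) => meanSign q i := by
    unfold meanSign
    exact Finset.measurable_sum _ fun a _ => (hm a).mul_const _
  unfold totalMeanSign
  refine Measurable.add (hq.comp ?_) (hq.comp ?_) <;> fun_prop

theorem expectedGap_signGame (ξ : stdSimplex ℝ Unit)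
    (β : Fin H → Unit → stdSimplex ℝ ((Fin k → Bool) × (Fin k → Bool)))
    {alg : Dataset Unit (Fin k → Bool) (Fin k → Bool) H K →
      Policy Unit (Fin k → Bool) H × Policy Unit (Fin k → Bool) H} (halg : Measurable alg)
    (θ : Fin H → Fin k → Bool) :
    expectedGap (signGame hΔ hΔk θ) ξ β alg = ∑ t : Step H 0, ∑ i, Δ / 2 *
      (2 - boolSign (θ t.1 i) * ∫ D, totalMeanSign t.1 i (alg D)
        ∂(datasetLaw (signGame hΔ hΔk θ) ξ β K)) := by
  have : IsProbabilityMeasure (datasetLaw (signGame hΔ hΔk θ) ξ β K) := by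
    unfold datasetLaw; infer_instance
  have hint : ∀ (t : Fin H) (i : Fin k), Integrable (fun D => totalMeanSign t i (alg D))
      (datasetLaw (signGame hΔ hΔk θ) ξ β K) := fun t i =>
    Integrable.of_bound ((measurable_totalMeanSign t i).comp halg).aestronglyMeasurable 2
      (ae_of_all _ fun D => abs_totalMeanSign_le t i (alg D))
  have hgap : ∀ D, ∑ x, ξ.1 x * dualityGap (signGame hΔ hΔk θ) (alg D).1 (alg D).2 x =
      ∑ t : Step H 0, ∑ i, Δ / 2 *
        (2 - boolSign (θ t.1 i) * totalMeanSign t.1 i (alg D)) := by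
    intro D
    have hξ : ξ.1 default = 1 := simplex_unit ξ
    rw [Fintype.sum_unique, hξ, one_mul, dualityGap_signGame]
    rfl
  have hint' : ∀ (t : Fin H) (i : Fin k), Integrable
      (fun D => Δ / 2 * (2 - boolSign (θ t i) * totalMeanSign t i (alg D)))
      (datasetLaw (signGame hΔ hΔk θ) ξ β K) := fun t i =>
    ((integrable_const 2).sub ((hint t i).const_mul _)).const_mul _
  unfold expectedGap
  simp_rw [hgap]
  rw [integral_finsetSum _ fun t _ => integrable_finsetSum _ fun i _ => hint' t.1 i]
  refine Finset.sum_congr rfl fun t _ => ?_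
  rw [integral_finsetSum _ fun i _ => hint' t.1 i]
  refine Finset.sum_congr rfl fun i _ => ?_
  rw [integral_const_mul, integral_sub (integrable_const 2) ((hint t.1 i).const_mul _),
    integral_const_mul]
  simp

/-- Averaging over all sign vectors: any algorithm has an average expected duality gap of order
`Δ H k`, as long as neighbouring games cannot be distinguished. -/
theorem le_sum_expectedGap_signGame (hk : 0 < k) (ξ : stdSimplex ℝ Unit)
    (hχ : (1 + (Real.exp (4 * Δ ^ 2) - 1) / k) ^ K ≤ 5 / 4)
    {alg : Dataset Unit (Fin k → Bool) (Fin k → Bool) H K →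
      Policy Unit (Fin k → Bool) H × Policy Unit (Fin k → Bool) H} (halg : Measurable alg) :
    Fintype.card (Fin H → Fin k → Bool) * (3 / 4 * Δ * H * k) ≤
      ∑ θ, expectedGap (signGame hΔ hΔk θ) ξ (fun _ _ => probePolicy hk) alg := by
  set I : Fin H → Fin k → (Fin H → Fin k → Bool) → ℝ := fun h i θ =>
    ∫ D, totalMeanSign h i (alg D)
      ∂(datasetLaw (signGame hΔ hΔk θ) ξ (fun _ _ => probePolicy hk) K) with hI
  -- The integrand is bounded by `2` and `5/4 = 1 + (1/2)²`, so the expectations differ by at most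
  -- `2 · (1/2)`.
  have hclose : ∀ h i θ, |I h i (flipSign h i θ) - I h i θ| ≤ 1 := by
    intro h i θ
    have := abs_integral_datasetLaw_sub_le (G := signGame hΔ hΔk θ)
      (G' := signGame hΔ hΔk (flipSign h i θ)) rfl ξ (fun _ _ => probePolicy hk)
      (ε := 1 / 2) (by norm_num) (K := K)
      (by rw [integral_likelihoodRatio_flipSign_sq]; exact hχ.trans (by norm_num))
      ((measurable_totalMeanSign h i).comp halg)
      (fun D => abs_totalMeanSign_le h i (alg D))
    simpa using this
  have hcoord : ∀ h i, Fintype.card (Fin H → Fin k → Bool) * (3 / 2 : ℝ) ≤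
      ∑ θ : Fin H → Fin k → Bool, (2 - boolSign (θ h i) * I h i θ) := by
    intro h i
    -- Reindexing by the flip pairs each game with its neighbour. A pair contributes at least `2 + 2
    -- - 1 = 3`, hence `3/2` per game.
    have hflip : ∑ θ : Fin H → Fin k → Bool, (2 - boolSign (θ h i) * I h i θ) =
        ∑ θ : Fin H → Fin k → Bool, (2 + boolSign (θ h i) * I h i (flipSign h i θ)) := by
      rw [← Equiv.sum_comp (flipSign_involutive h i).toPerm]
      refine Finset.sum_congr rfl fun θ _ => ?_
      simp only [Function.Involutive.coe_toPerm, flipSign_self, boolSign_not]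
      ring
    have htwo : ∑ _θ : Fin H → Fin k → Bool, (3 : ℝ) ≤
        ∑ θ : Fin H → Fin k → Bool, ((2 - boolSign (θ h i) * I h i θ) +
          (2 + boolSign (θ h i) * I h i (flipSign h i θ))) := by
      refine Finset.sum_le_sum fun θ _ => ?_
      have h1 : |boolSign (θ h i) * (I h i (flipSign h i θ) - I h i θ)| ≤ 1 := by
        rw [abs_mul, abs_boolSign, one_mul]; exact hclose h i θ
      linarith [(abs_le.1 h1).1]
    rw [Finset.sum_add_distrib, ← hflip, Finset.sum_const, nsmul_eq_mul, Finset.card_univ] at htwo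
    linarith
  simp_rw [expectedGap_signGame hΔ hΔk ξ (fun _ _ => probePolicy hk) halg]
  rw [Finset.sum_comm]
  calc _ = ∑ _t : Step H 0, ∑ _i : Fin k, Δ / 2 *
        (Fintype.card (Fin H → Fin k → Bool) * (3 / 2 : ℝ)) := by
        rw [Finset.sum_const, Finset.sum_const, Finset.card_univ, Finset.card_univ,
          card_step_zero, Fintype.card_fin, nsmul_eq_mul, nsmul_eq_mul]
        ring
    _ ≤ _ := by
        refine Finset.sum_le_sum fun t _ => ?_
        rw [Finset.sum_comm]
        refine Finset.sum_le_sum fun i _ => ?_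
        rw [← Finset.mul_sum]
        exact mul_le_mul_of_nonneg_left (hcoord t.1 i) (by positivity)

theorem le_iSup_expectedGap_signGame (hk : 0 < k) (ξ : stdSimplex ℝ Unit)
    (hχ : (1 + (Real.exp (4 * Δ ^ 2) - 1) / k) ^ K ≤ 5 / 4)
    {alg : Dataset Unit (Fin k → Bool) (Fin k → Bool) H K →
      Policy Unit (Fin k → Bool) H × Policy Unit (Fin k → Bool) H} (halg : Measurable alg) :
    3 / 4 * Δ * H * k ≤ ⨆ M : Set.range (signGame (H := H) hΔ hΔk),
      expectedGap M.1 ξ (fun _ _ => probePolicy hk) alg := by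
  -- The class is finite, so the real supremum is a genuine one and dominates the average over `θ`.
  have hbdd : BddAbove (Set.range fun M : Set.range (signGame (H := H) hΔ hΔk) =>
      expectedGap M.1 ξ (fun _ _ => probePolicy hk) alg) := (Set.finite_range _).bddAbove
  have hcard : (0 : ℝ) < Fintype.card (Fin H → Fin k → Bool) := by
    exact_mod_cast Fintype.card_pos
  refine le_of_mul_le_mul_left
    ((le_sum_expectedGap_signGame hΔ hΔk hk ξ hχ halg).trans ?_) hcard
  rw [← nsmul_eq_mul, ← Finset.card_univ]
  exact Finset.sum_le_card_nsmul _ _ _ fun θ _ => le_ciSup hbdd ⟨_, θ, rfl⟩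

/-- The bound on the second moment of the likelihood ratio for gaps of order `√(k / K)`. -/
theorem one_add_exp_sub_one_div_pow_le (hk : 0 < k) (hKk : k ≤ K) {x : ℝ}
    (hx : x = (k : ℝ) / (16 * K)) : (1 + (Real.exp x - 1) / k) ^ K ≤ 5 / 4 := by
  have hk' : (0 : ℝ) < k := by exact_mod_cast hk
  have hK' : (0 : ℝ) < K := by exact_mod_cast hk.trans_le hKk
  have hKk' : (k : ℝ) ≤ K := by exact_mod_cast hKk
  have hx0 : 0 ≤ x := by rw [hx]; positivity
  have hx1 : x ≤ 1 := by
    rw [hx, div_le_one (by positivity)]; linarith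
  have he : Real.exp x - 1 ≤ 2 * x := by
    have := (abs_le.1 (Real.abs_exp_sub_one_le (x := x) (by rwa [abs_of_nonneg hx0]))).2
    rwa [abs_of_nonneg hx0] at this
  have he0 : 0 ≤ Real.exp x - 1 := by linarith [Real.add_one_le_exp x]
  -- The `K`-th power is then at most `e^{1/8} ≤ 1 + 2/8 = 5/4`.
  have hstep : (Real.exp x - 1) / k ≤ 1 / (8 * K) := by
    rw [div_le_div_iff₀ hk' (by positivity)]
    calc (Real.exp x - 1) * (8 * K) ≤ 2 * x * (8 * K) := by gcongr
      _ = 1 * k := by rw [hx]; field_simp; norm_num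
  calc (1 + (Real.exp x - 1) / k) ^ K ≤ (1 + 1 / (8 * K)) ^ K :=
        pow_le_pow_left₀ (by positivity) (by linarith) K
    _ ≤ Real.exp (1 / (8 * K)) ^ K := by
        gcongr
        linarith [Real.add_one_le_exp (1 / (8 * K) : ℝ)]
    _ = Real.exp (1 / 8) := by
        rw [← Real.exp_nat_mul]; congr 1; field_simp
    _ ≤ 5 / 4 := by
        have := (abs_le.1 (Real.abs_exp_sub_one_le (x := 1 / 8) (by norm_num [abs_of_nonneg]))).2
        rw [abs_of_nonneg (by norm_num)] at this
        linarith

/-- With probability at least `1 - δ` every probing pair is played at least `K / (4 k)` times at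
every step. -/
theorem one_sub_le_measureReal_probeCount (hk : 0 < k) (hH : 1 ≤ H)
    (G : MarkovGame Unit (Fin k → Bool) (Fin k → Bool) H) (ξ : stdSimplex ℝ Unit) {δ : ℝ}
    (hδ : 0 < δ) (hK : 20 * k * Real.log (2 * H * k / δ) ≤ K) :
    1 - δ ≤ (datasetLaw G ξ (fun _ _ => probePolicy hk) K).real
      {D | ∀ h j, K * (2 * k : ℝ)⁻¹ / 2 ≤ probeCount D h j} := by
  have hk' : (0 : ℝ) < k := by exact_mod_cast hk
  have hH' : (0 : ℝ) < H := by exact_mod_cast hH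
  set μ := datasetLaw G ξ (fun _ _ => probePolicy hk) K with hμ
  have : IsProbabilityMeasure μ := by
    rw [hμ]; unfold datasetLaw; infer_instance
  set good := {D : Dataset Unit (Fin k → Bool) (Fin k → Bool) H K |
    ∀ h j, K * (2 * k : ℝ)⁻¹ / 2 ≤ probeCount D h j} with hgood
  have hbad : μ.real goodᶜ ≤ δ := by
    -- Union bound over `2Hk` events, each of probability at most `exp(-K/(20k)) ≤ δ/(2Hk)`.
    have hsub : goodᶜ ⊆ ⋃ hj ∈ (Finset.univ : Finset (Step H 0 × (Fin k × Bool))),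
        {D | (probeCount D hj.1 hj.2 : ℝ) ≤ K * (2 * k : ℝ)⁻¹ / 2} := by
      intro D hD
      simp only [hgood, Set.mem_compl_iff, Set.mem_ofPred_eq, not_forall, not_le] at hD
      obtain ⟨h, j, hj⟩ := hD
      simp only [Finset.mem_univ, Set.iUnion_true, Set.mem_iUnion]
      exact ⟨(h, j), hj.le⟩
    calc μ.real goodᶜ ≤ _ := measureReal_mono hsub (measure_ne_top μ _)
      _ ≤ ∑ hj : Step H 0 × (Fin k × Bool),
          μ.real {D | (probeCount D hj.1 hj.2 : ℝ) ≤ K * (2 * k : ℝ)⁻¹ / 2} :=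
        measureReal_biUnion_finset_le _ _
      _ ≤ ∑ _hj : Step H 0 × (Fin k × Bool), Real.exp (-(K * (2 * k : ℝ)⁻¹ / 10)) :=
        Finset.sum_le_sum fun hj _ => measureReal_probeCount_le hk G ξ hj.1 hj.2
      _ = 2 * H * k * Real.exp (-(K * (2 * k : ℝ)⁻¹ / 10)) := by
        rw [Finset.sum_const, Finset.card_univ, Fintype.card_prod, Fintype.card_prod,
          card_step_zero, Fintype.card_fin, Fintype.card_bool, nsmul_eq_mul]
        push_cast
        ring
      _ ≤ 2 * H * k * Real.exp (-Real.log (2 * H * k / δ)) := by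
        gcongr
        rw [show K * (2 * k : ℝ)⁻¹ / 10 = K / (20 * k) by field_simp; ring,
          le_div_iff₀ (by positivity)]
        linarith
      _ = δ := by
        rw [Real.exp_neg, Real.exp_log (by positivity)]
        field_simp
  have huniv : (1 : ℝ) ≤ μ.real good + μ.real goodᶜ := by
    calc (1 : ℝ) = μ.real (good ∪ goodᶜ) := by rw [Set.union_compl_self]; simp
      _ ≤ _ := measureReal_union_le _ _
  linarith

end LowerBound

end OfflineMG

/-! ### Choice of constants and conclusion. -/

theorem theorem5 :
    ∃ c C : ℝ, 0 < c ∧ 0 < C ∧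
      ∀ (H d K : ℕ) (δ : ℝ), 1 ≤ H → 2 ≤ d → 0 < δ → δ < 1 →
        C * (d : ℝ) ^ 4 * Real.log (2 * H * d / δ) ≤ K →
        ∃ (S A B : Type) (_ : Fintype S) (_ : DecidableEq S) (_ : Fintype A) (_ : Fintype B)
          (φ : S → A → B → EuclideanSpace ℝ (Fin d))
          (ξ : stdSimplex ℝ S) (β : Fin H → S → stdSimplex ℝ (A × B))
          (𝓜 : Set (OfflineMG.MarkovGame S A B H)),
          𝓜.Nonempty ∧
          (∀ G ∈ 𝓜, OfflineMG.IsLinear G φ ∧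
            (∀ h, (OfflineMG.featureCov G φ ξ β h).PosDef) ∧
            ∃ πs νs, OfflineMG.IsNash G πs νs) ∧
          ∀ alg : OfflineMG.Dataset S A B H K →
              OfflineMG.Policy S A H × OfflineMG.Policy S B H, Measurable alg →
            ∀ reg : ℝ, 0 < reg →
              ∀ G ∈ 𝓜, ∀ πs νs, OfflineMG.IsNash G πs νs →
                1 - δ ≤ (OfflineMG.datasetLaw G ξ β K).real
                  {D | c * √(d : ℝ) * OfflineMG.complexity G φ reg ξ πs νs D ≤
                    ⨆ M : 𝓜, OfflineMG.expectedGap M.1 ξ β alg} := by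
  -- `20` is the constant in the coverage condition `K ≥ 20 k log(2Hk/δ)`. `1/128` makes the closing
  -- chain end in an equality: `(1/128) · 3 · 4 = 3/32 = (3/4) · (1/8)`.
  refine ⟨1 / 128, 20, by norm_num, by norm_num, fun H d K δ hH hd hδ hδ1 hK => ?_⟩
  obtain ⟨k, rfl⟩ : ∃ k, d = k + 1 := ⟨d - 1, by omega⟩
  have hk : 0 < k := by omega
  have hk1 : (1 : ℝ) ≤ k := by exact_mod_cast hk
  have hk' : (0 : ℝ) < k := by linarith
  have hH1 : (1 : ℝ) ≤ H := by exact_mod_cast hH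
  push_cast at hK
  have hlog : Real.log (2 * H * k / δ) ≤ Real.log (2 * H * (k + 1) / δ) := by
    apply Real.log_le_log (by positivity)
    gcongr
    linarith
  -- With the logarithm bounded below, the sample-size hypothesis also gives `K ≥ k³`, needed to
  -- keep the rewards in `[0, 1]`.
  have hlog1 : 1 / 2 ≤ Real.log (2 * H * (k + 1) / δ) := by
    have h2 : (2 : ℝ) ≤ 2 * H * (k + 1) / δ := by
      rw [le_div_iff₀ hδ]
      nlinarith [mul_le_mul hH1 hk1 zero_le_one (by positivity)]
    linarith [Real.log_two_gt_d9, Real.log_le_log (by norm_num) h2]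
  have hpow : (k : ℝ) ^ 3 ≤ ((k : ℝ) + 1) ^ 4 :=
    (pow_le_pow_left₀ hk'.le (by linarith) 3).trans
      (pow_le_pow_right₀ (by linarith) (by norm_num))
  have hpow1 : (k : ℝ) ≤ (k : ℝ) ^ 3 := le_self_pow₀ hk1 (by norm_num)
  have hKk3 : (k : ℝ) ^ 3 ≤ K := by nlinarith
  have hKlog : 20 * k * Real.log (2 * H * k / δ) ≤ K := by
    refine le_trans ?_ hK
    calc 20 * k * Real.log (2 * H * k / δ) ≤ 20 * k * Real.log (2 * H * (k + 1) / δ) := by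
          gcongr
      _ ≤ _ := by gcongr; linarith
  have hKk : (k : ℝ) ≤ K := hpow1.trans hKk3
  have hK0 : (0 : ℝ) < K := by linarith
  -- The gap is at the order of the detection threshold: `4Δ²/k = 1/(16K)` keeps the divergence of
  -- `K` samples constant.
  obtain ⟨Δ, hΔdef⟩ : ∃ Δ : ℝ, Δ = √k / (8 * √K) := ⟨_, rfl⟩
  have hΔ : 0 ≤ Δ := by rw [hΔdef]; positivity
  have hΔsq : 4 * Δ ^ 2 = (k : ℝ) / (16 * K) := by
    rw [hΔdef, div_pow, mul_pow, Real.sq_sqrt hk'.le, Real.sq_sqrt hK0.le]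
    field_simp
    norm_num
  have hΔk : Δ * k ≤ 1 / 2 := by
    refine abs_le_of_sq_le_sq' ?_ (by norm_num) |>.2
    have : (Δ * k) ^ 2 = (k : ℝ) ^ 3 / (64 * K) := by
      rw [mul_pow, show Δ ^ 2 = (k : ℝ) / (16 * K) / 4 by linarith]
      field_simp
      norm_num
    rw [this, div_le_iff₀ (by positivity)]
    linarith
  have hχ := OfflineMG.one_add_exp_sub_one_div_pow_le hk (by exact_mod_cast hKk) hΔsq
  refine ⟨Unit, Fin k → Bool, Fin k → Bool, inferInstance, inferInstance, inferInstance,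
    inferInstance, OfflineMG.signFeature k, ⟨fun _ => 1, fun _ => zero_le_one, by simp⟩,
    fun _ _ => OfflineMG.probePolicy hk, Set.range (OfflineMG.signGame hΔ hΔk),
    Set.range_nonempty _, ?_, ?_⟩
  · rintro _ ⟨θ, rfl⟩
    exact ⟨OfflineMG.isLinear_signGame hΔ hΔk hk θ,
      fun h => OfflineMG.posDef_featureCov_probePolicy hk _ _ h,
      _, _, OfflineMG.isNash_signGame hΔ hΔk θ⟩
  · intro alg halg reg hreg G _ πs νs _
    have : IsProbabilityMeasure (OfflineMG.datasetLaw G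
        ⟨fun _ => 1, fun _ => zero_le_one, by simp⟩ (fun _ _ => OfflineMG.probePolicy hk) K) := by
      unfold OfflineMG.datasetLaw; infer_instance
    -- The supremum does not depend on the dataset, so it suffices to bound the complexity on the
    -- coverage event.
    refine (OfflineMG.one_sub_le_measureReal_probeCount hk hH G _ hδ hKlog).trans
      (measureReal_mono fun D hD => ?_)
    refine le_trans ?_ (OfflineMG.le_iSup_expectedGap_signGame hΔ hΔk hk _ hχ halg)
    have hn : (0 : ℝ) < K * (2 * k : ℝ)⁻¹ / 2 := by positivity
    have hcomp := OfflineMG.complexity_le hk G ⟨fun _ => 1, fun _ => zero_le_one, by simp⟩ hreg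
      πs νs D hn hD
    have hroot : √(k / (K * (2 * k : ℝ)⁻¹ / 2)) = 2 * k / √K := by
      rw [show (k / (K * (2 * k : ℝ)⁻¹ / 2) : ℝ) = (2 * k) ^ 2 / K by field_simp,
        Real.sqrt_div (by positivity), Real.sqrt_sq (by positivity)]
    rw [hroot] at hcomp
    -- `√d` is traded for `√k`, up to a generous factor that is valid since `k ≥ 1`.
    have hsq : √((k + 1 : ℕ) : ℝ) ≤ 3 * √k := by
      rw [Real.sqrt_le_left (by positivity), mul_pow, Real.sq_sqrt hk'.le]
      push_cast
      linarith
    calc _ ≤ 1 / 128 * √((k + 1 : ℕ) : ℝ) * (2 * (H * (2 * k / √K))) :=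
          mul_le_mul_of_nonneg_left hcomp (by positivity)
      _ ≤ 1 / 128 * (3 * √k) * (2 * (H * (2 * k / √K))) := by gcongr
      _ = 3 / 4 * Δ * H * k := by rw [hΔdef]; field_simp; norm_num
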